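/- Let $k$ be a field and $H$ a Hopf algebra over $k$ with antipode $S$. A right integral on $H$ is a linear functional $\chi:H\to k$ with $\sum\chi(a_{(1)})a_{(2)}=\chi(a)1$ for all $a\in H$, a left integral is a linear functional $\varphi:H\to k$ with $\sum a_{(1)}\varphi(a_{(2)})=\varphi(a)1$ for all $a\in H$; let $\int_r$ be the space of right integrals. Let $H^*$ be the dual algebra with the convolution product $(\xi\eta)(h)=\sum\xi(h_{(1)})\eta(h_{(2)})$. Every right $H$-comodule $N$ is a left $H^*$-module by $\xi * n=\sum n_{(0)}\xi(n_{(1)})$. Let $T:\mathrm{Comod}\text{-}H\to H^*\text{-}\mathrm{Mod}$ be the functor $X\mapsto \mathrm{Hom}^H(H,X)$ into left $H^*$-modules, where $(\xi * f)(h)=\sum\xi(h_{(1)})f(h_{(2)})$. For a finite-dimensional right comodule $N$, let $N^*$ be the dual comodule, with coaction determined by $\sum\varphi_{(0)}(x)\varphi_{(1)}=\sum\varphi(x_{(0)})S(x_{(1)})$. Suppose that $H$ has a non-zero integral (right or left). Then $T$ has a left adjoint; $\int_r$ is one-dimensional; and there is a group-like element $\gamma\in H$ (the distinguished group-like element) with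 $\sum a_{(1)}\chi(a_{(2)})=\chi(a)\gamma$ for all $\chi\in\int_r$ and $a\in H$. Let $\Gamma$ be the one-dimensional right comodule $\int_r$ with coaction $\chi\mapsto\chi\otimes\gamma$. Then for every left adjoint $U$ of $T$ and every finite-dimensional right $H$-comodule $N$, the comodule $U(N)$ is finite-dimensional and $$U(N)^{**}\;\cong\; N\otimes\Gamma^*$$ as right $H$-comodules. -/

import Mathlib

open CategoryTheory TensorProduct Coalgebra HopfAlgebra

universe u

namespace HopfComod

section Antipode

variable {k H : Type u} [Field k] [Ring H] [HopfAlgebra k H]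

/-- The antipode reverses the comultiplication: `Δ (S h) = S h₂ ⊗ S h₁`. -/
theorem comul_antipode :
    (comul : H →ₗ[k] H ⊗[k] H) ∘ₗ antipode k =
      TensorProduct.map (antipode k) (antipode k) ∘ₗ
        (TensorProduct.comm k H H).toLinearMap ∘ₗ comul := by
  let i₁ : H →ₐ[k] H ⊗[k] H := Algebra.TensorProduct.includeLeft
  let i₂ : H →ₐ[k] H ⊗[k] H := Algebra.TensorProduct.includeRight
  have key : ∀ i : H →ₐ[k] H ⊗[k] H,
      WithConv.toConv (i.toLinearMap ∘ₗ antipode k (A := H)) * WithConv.toConv i.toLinearMap =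
        (1 : WithConv (H →ₗ[k] H ⊗[k] H)) := by
    intro i
    have h := LinearMap.algHom_comp_convMul_distrib i
      (WithConv.toConv (antipode k (A := H))) (WithConv.toConv LinearMap.id)
    rw [LinearMap.antipode_mul_id] at h
    apply WithConv.ext
    rw [LinearMap.comp_id] at h
    exact h.symm.trans (by ext x; simp [LinearMap.convOne_def])
  have hd : WithConv.toConv i₁.toLinearMap * WithConv.toConv i₂.toLinearMap =
      WithConv.toConv (comul : H →ₗ[k] H ⊗[k] H) := by
    ext c
    rw [(ℛ k c).convMul_apply]
    conv_rhs => simp only [WithConv.ofConv_toConv]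
    rw [← (ℛ k c).eq]
    simp [i₁, i₂]
  have hg : WithConv.toConv (i₂.toLinearMap ∘ₗ antipode k (A := H)) *
      WithConv.toConv (i₁.toLinearMap ∘ₗ antipode k (A := H)) =
      WithConv.toConv (TensorProduct.map (antipode k) (antipode k) ∘ₗ
        (TensorProduct.comm k H H).toLinearMap ∘ₗ (comul : H →ₗ[k] H ⊗[k] H)) := by
    ext c
    rw [(ℛ k c).convMul_apply]
    conv_rhs => simp only [WithConv.ofConv_toConv, LinearMap.comp_apply]
    rw [← (ℛ k c).eq]
    simp [i₁, i₂]
  apply WithConv.toConv_injective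
  refine (left_inv_eq_right_inv (a := WithConv.toConv (comul : H →ₗ[k] H ⊗[k] H)) ?_
    LinearMap.comul_right_inv).symm
  rw [← hg, ← hd, mul_assoc, ← mul_assoc (WithConv.toConv (i₁.toLinearMap ∘ₗ antipode k)),
    key, one_mul, key]

end Antipode

section Comodules

/-- Right comodules over `H` (with carrier in the universe of `k` and `H`). -/
structure RightComod (k H : Type u) [Field k] [Ring H] [HopfAlgebra k H] where
  carrier : Type u
  [addCommGroup : AddCommGroup carrier]
  [module : Module k carrier]
  /-- The coaction `n ↦ n₀ ⊗ n₁`. -/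
  coact : carrier →ₗ[k] carrier ⊗[k] H
  coassoc : (TensorProduct.assoc k carrier H H).toLinearMap ∘ₗ coact.rTensor H ∘ₗ coact =
    (comul : H →ₗ[k] H ⊗[k] H).lTensor carrier ∘ₗ coact
  counit_coact : (TensorProduct.rid k carrier).toLinearMap ∘ₗ
    (counit : H →ₗ[k] k).lTensor carrier ∘ₗ coact = LinearMap.id

attribute [instance] RightComod.addCommGroup RightComod.module

variable {k H : Type u} [Field k] [Ring H] [HopfAlgebra k H]

instance : CoeSort (RightComod k H) (Type u) := ⟨RightComod.carrier⟩

/-- `Hom^H(M, N)`: the space of `H`-comodule maps. -/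
def homSpace (M N : RightComod k H) : Submodule k (M →ₗ[k] N) where
  carrier := {f | N.coact ∘ₗ f = f.rTensor H ∘ₗ M.coact}
  add_mem' {f g} hf hg := by
    simp only [Set.mem_ofPred_eq] at *
    rw [LinearMap.comp_add, LinearMap.rTensor_add, LinearMap.add_comp, hf, hg]
  zero_mem' := by simp
  smul_mem' c f hf := by
    simp only [Set.mem_ofPred_eq] at *
    rw [LinearMap.comp_smul, LinearMap.rTensor_smul, LinearMap.smul_comp, hf]

/-- The category Comod-`H`. -/
instance : Category (RightComod k H) where
  Hom M N := homSpace M N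
  id M := ⟨LinearMap.id, by
    change _ ∘ₗ _ = _
    rw [LinearMap.rTensor_id, LinearMap.comp_id, LinearMap.id_comp]⟩
  comp {M N P} f g := ⟨g.1 ∘ₗ f.1, by
    have hf : N.coact ∘ₗ f.1 = f.1.rTensor H ∘ₗ M.coact := f.2
    have hg : P.coact ∘ₗ g.1 = g.1.rTensor H ∘ₗ N.coact := g.2
    change _ ∘ₗ _ = _
    rw [← LinearMap.comp_assoc, hg, LinearMap.comp_assoc, hf, LinearMap.rTensor_comp,
      LinearMap.comp_assoc]⟩

variable (k H) in
/-- `H` as a right comodule over itself, through its comultiplication. -/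
abbrev regular : RightComod k H where
  carrier := H
  coact := comul
  coassoc := Coalgebra.coassoc
  counit_coact := by
    rw [Coalgebra.lTensor_counit_comp_comul]
    ext x
    simp

/-- The tensor product of comodules: `m ⊗ n ↦ m₀ ⊗ n₀ ⊗ m₁ n₁`. -/
def tensor (M N : RightComod k H) : RightComod k H where
  carrier := M ⊗[k] N
  coact := (LinearMap.mul' k H).lTensor (M ⊗[k] N) ∘ₗ
    (TensorProduct.tensorTensorTensorComm k M H N H).toLinearMap ∘ₗ
      TensorProduct.map M.coact N.coact
  coassoc := by
    let μ : (M ⊗[k] H) ⊗[k] (N ⊗[k] H) →ₗ[k] (M ⊗[k] N) ⊗[k] H :=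
      (LinearMap.mul' k H).lTensor (M ⊗[k] N) ∘ₗ
        (TensorProduct.tensorTensorTensorComm k M H N H).toLinearMap
    let ν : (M ⊗[k] (H ⊗[k] H)) ⊗[k] (N ⊗[k] (H ⊗[k] H)) →ₗ[k] (M ⊗[k] N) ⊗[k] (H ⊗[k] H) :=
      (LinearMap.mul' k (H ⊗[k] H)).lTensor (M ⊗[k] N) ∘ₗ
        (TensorProduct.tensorTensorTensorComm k M (H ⊗[k] H) N (H ⊗[k] H)).toLinearMap
    have h1 : (comul : H →ₗ[k] H ⊗[k] H).lTensor (M ⊗[k] N) ∘ₗ μ =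
        ν ∘ₗ TensorProduct.map ((comul : H →ₗ[k] H ⊗[k] H).lTensor M)
          ((comul : H →ₗ[k] H ⊗[k] H).lTensor N) := by
      ext m h n h'
      simp [μ, ν]
    have h2 : ∀ (x : M ⊗[k] H) (y : N ⊗[k] H) (h h' : H),
        TensorProduct.assoc k (M ⊗[k] N) H H (μ (x ⊗ₜ y) ⊗ₜ (h * h')) =
          ν (TensorProduct.assoc k M H H (x ⊗ₜ h) ⊗ₜ TensorProduct.assoc k N H H (y ⊗ₜ h')) := by
      intro x y h h'
      induction x with
      | zero => simp
      | add x₁ x₂ hx₁ hx₂ => simp only [TensorProduct.add_tmul, map_add, hx₁, hx₂]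
      | tmul m a =>
        induction y with
        | zero => simp
        | add y₁ y₂ hy₁ hy₂ =>
          simp only [TensorProduct.add_tmul, TensorProduct.tmul_add, map_add, hy₁, hy₂]
        | tmul n b => simp [μ, ν]
    have h3 : (TensorProduct.assoc k (M ⊗[k] N) H H).toLinearMap ∘ₗ
        (μ ∘ₗ TensorProduct.map M.coact N.coact).rTensor H ∘ₗ μ =
        ν ∘ₗ TensorProduct.map
          ((TensorProduct.assoc k M H H).toLinearMap ∘ₗ M.coact.rTensor H)
          ((TensorProduct.assoc k N H H).toLinearMap ∘ₗ N.coact.rTensor H) := by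
      ext m h n h'
      have := h2 (M.coact m) (N.coact n) h h'
      simpa [μ] using this
    change (TensorProduct.assoc k (M ⊗[k] N) H H).toLinearMap ∘ₗ
        (μ ∘ₗ TensorProduct.map M.coact N.coact).rTensor H ∘ₗ
          (μ ∘ₗ TensorProduct.map M.coact N.coact) =
      (comul : H →ₗ[k] H ⊗[k] H).lTensor (M ⊗[k] N) ∘ₗ
        (μ ∘ₗ TensorProduct.map M.coact N.coact)
    rw [← LinearMap.comp_assoc _ μ, ← LinearMap.comp_assoc _ _ (LinearEquiv.toLinearMap _), h3,
      ← LinearMap.comp_assoc _ μ, h1, LinearMap.comp_assoc _ _ ν, LinearMap.comp_assoc _ _ ν,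
      ← TensorProduct.map_comp, ← TensorProduct.map_comp, LinearMap.comp_assoc M.coact,
      LinearMap.comp_assoc N.coact, M.coassoc, N.coassoc]
  counit_coact := by
    let μ : (M ⊗[k] H) ⊗[k] (N ⊗[k] H) →ₗ[k] (M ⊗[k] N) ⊗[k] H :=
      (LinearMap.mul' k H).lTensor (M ⊗[k] N) ∘ₗ
        (TensorProduct.tensorTensorTensorComm k M H N H).toLinearMap
    have h1 : (TensorProduct.rid k (M ⊗[k] N)).toLinearMap ∘ₗ
        (counit : H →ₗ[k] k).lTensor (M ⊗[k] N) ∘ₗ μ =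
        TensorProduct.map
          ((TensorProduct.rid k M).toLinearMap ∘ₗ (counit : H →ₗ[k] k).lTensor M)
          ((TensorProduct.rid k N).toLinearMap ∘ₗ (counit : H →ₗ[k] k).lTensor N) := by
      ext m h n h'
      simp [μ, TensorProduct.smul_tmul', TensorProduct.tmul_smul, smul_smul, mul_comm]
    change (TensorProduct.rid k (M ⊗[k] N)).toLinearMap ∘ₗ
        (counit : H →ₗ[k] k).lTensor (M ⊗[k] N) ∘ₗ
          (μ ∘ₗ TensorProduct.map M.coact N.coact) = LinearMap.id
    rw [← LinearMap.comp_assoc _ μ, ← LinearMap.comp_assoc _ _ (LinearEquiv.toLinearMap _), h1,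
      ← TensorProduct.map_comp, LinearMap.comp_assoc, LinearMap.comp_assoc, M.counit_coact,
      N.counit_coact, TensorProduct.map_id]

/-- For `φ ∈ N^*`, the map `x ↦ φ(x₀) S(x₁)`. -/
def dualAux (N : RightComod k H) : Module.Dual k N →ₗ[k] (N →ₗ[k] H) where
  toFun φ := antipode k ∘ₗ (TensorProduct.lid k H).toLinearMap ∘ₗ φ.rTensor H ∘ₗ N.coact
  map_add' φ ψ := by
    rw [LinearMap.rTensor_add, LinearMap.add_comp, LinearMap.comp_add, LinearMap.comp_add]
  map_smul' c φ := by
    rw [LinearMap.rTensor_smul, LinearMap.smul_comp, LinearMap.comp_smul, LinearMap.comp_smul]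
    rfl

/-- The coaction `φ ↦ φ₀ ⊗ φ₁` on `N^*`, determined by `φ₀(x) φ₁ = φ(x₀) S(x₁)`. -/
noncomputable def dualCoact (N : RightComod k H) [FiniteDimensional k N] :
    Module.Dual k N →ₗ[k] Module.Dual k N ⊗[k] H :=
  (dualTensorHomEquiv k N H).symm.toLinearMap ∘ₗ dualAux N

theorem dualTensorHom_dualCoact (N : RightComod k H) [FiniteDimensional k N]
    (φ : Module.Dual k N) : dualTensorHom k N H (dualCoact N φ) = dualAux N φ :=
  (dualTensorHomEquiv k N H).apply_symm_apply (dualAux N φ)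

theorem dualTensorHom_lTensor {N A B : Type u} [AddCommGroup N] [Module k N]
    [AddCommGroup A] [Module k A] [AddCommGroup B] [Module k B] (g : A →ₗ[k] B)
    (t : Module.Dual k N ⊗[k] A) :
    dualTensorHom k N B (g.lTensor _ t) = g ∘ₗ dualTensorHom k N A t := by
  induction t with
  | zero => simp
  | add x y hx hy => rw [map_add, map_add, map_add, hx, hy, LinearMap.comp_add]
  | tmul φ a => ext x; simp

/-- The (left) dual comodule `N^*` of a finite-dimensional comodule. -/
noncomputable def dual (N : RightComod k H) [FiniteDimensional k N] : RightComod k H where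
  carrier := Module.Dual k N
  coact := dualCoact N
  coassoc := by
    -- evaluation of `(ρ ⊗ id) t` at `x` is `S(x₁) ⊗ t(x₀)`
    have h1 : ∀ t : Module.Dual k N ⊗[k] H,
        dualTensorHom k N (H ⊗[k] H)
          (TensorProduct.assoc k _ H H ((dualCoact N).rTensor H t)) =
        (TensorProduct.comm k H H).toLinearMap ∘ₗ
          TensorProduct.map (dualTensorHom k N H t) (antipode k) ∘ₗ N.coact := by
      intro t
      induction t with
      | zero => simp
      | add x y hx hy =>
        simp only [map_add, hx, hy, TensorProduct.map_add_left, LinearMap.add_comp,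
          LinearMap.comp_add]
      | tmul φ h =>
        ext x
        have h2 : ∀ s : Module.Dual k N ⊗[k] H,
            dualTensorHom k N (H ⊗[k] H) (TensorProduct.assoc k _ H H (s ⊗ₜ h)) x =
              dualTensorHom k N H s x ⊗ₜ h := by
          intro s
          induction s with
          | zero => simp
          | add s₁ s₂ h₁ h₂ =>
            simp only [TensorProduct.add_tmul, map_add, LinearMap.add_apply, h₁, h₂]
          | tmul ψ a => simp [TensorProduct.smul_tmul']
        rw [LinearMap.rTensor_tmul, h2, dualTensorHom_dualCoact]
        simp only [dualAux, LinearMap.coe_mk, AddHom.coe_mk, LinearMap.comp_apply,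
          LinearEquiv.coe_coe]
        generalize N.coact x = y
        induction y with
        | zero => simp
        | add y₁ y₂ h₁ h₂ => simp only [map_add, TensorProduct.add_tmul, h₁, h₂]
        | tmul n a => simp [TensorProduct.smul_tmul', TensorProduct.tmul_smul]
    apply LinearMap.ext
    intro φ
    apply (dualTensorHomEquiv k N (H ⊗[k] H)).injective
    change dualTensorHom k N (H ⊗[k] H) (TensorProduct.assoc k _ H H
        ((dualCoact N).rTensor H (dualCoact N φ))) =
      dualTensorHom k N (H ⊗[k] H) ((comul : H →ₗ[k] H ⊗[k] H).lTensor _ (dualCoact N φ))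
    rw [h1, dualTensorHom_lTensor, dualTensorHom_dualCoact]
    have h3 : (comul : H →ₗ[k] H ⊗[k] H) ∘ₗ dualAux N φ =
        TensorProduct.map (antipode k) (antipode k) ∘ₗ (TensorProduct.comm k H H).toLinearMap ∘ₗ
          ((TensorProduct.lid k (H ⊗[k] H)).toLinearMap ∘ₗ φ.rTensor (H ⊗[k] H)) ∘ₗ
            ((comul : H →ₗ[k] H ⊗[k] H).lTensor N ∘ₗ N.coact) := by
      change (comul ∘ₗ antipode k) ∘ₗ (TensorProduct.lid k H).toLinearMap ∘ₗ φ.rTensor H ∘ₗ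
        N.coact = _
      rw [comul_antipode]
      apply LinearMap.ext
      intro x
      simp only [LinearMap.comp_apply]
      generalize N.coact x = y
      induction y with
      | zero => simp
      | add y₁ y₂ h₁ h₂ => simp only [map_add, h₁, h₂]
      | tmul n a => simp
    rw [h3, ← N.coassoc]
    apply LinearMap.ext
    intro x
    simp only [LinearMap.comp_apply]
    generalize N.coact x = y
    induction y with
    | zero => simp
    | add y₁ y₂ h₁ h₂ => simp only [map_add, h₁, h₂]
    | tmul n a =>
      simp only [dualAux, TensorProduct.map_tmul, LinearMap.rTensor_tmul, LinearMap.coe_mk,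
        AddHom.coe_mk, LinearMap.comp_apply]
      generalize N.coact n = z
      induction z with
      | zero => simp
      | add z₁ z₂ h₁ h₂ => simp only [map_add, TensorProduct.add_tmul, h₁, h₂]
      | tmul m b => simp [TensorProduct.smul_tmul', TensorProduct.tmul_smul]
  counit_coact := by
    have h1 : ∀ t : Module.Dual k N ⊗[k] k,
        TensorProduct.rid k (Module.Dual k N) t = dualTensorHom k N k t := by
      intro t
      induction t with
      | zero => simp
      | add x y hx hy => rw [map_add, map_add, hx, hy]
      | tmul φ a => ext x; simp [mul_comm]
    apply LinearMap.ext
    intro φ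
    simp only [LinearMap.comp_apply, LinearEquiv.coe_coe, LinearMap.id_apply]
    rw [h1, dualTensorHom_lTensor, dualTensorHom_dualCoact]
    apply LinearMap.ext
    intro x
    have h2 := LinearMap.congr_fun N.counit_coact x
    conv_rhs => rw [← LinearMap.id_apply (R := k) x, ← h2]
    simp only [dualAux, LinearMap.coe_mk, AddHom.coe_mk, LinearMap.comp_apply, counit_antipode]
    generalize N.coact x = y
    induction y with
    | zero => simp
    | add y₁ y₂ h₁ h₂ => simp only [map_add, h₁, h₂]
    | tmul n a => simp [mul_comm]

instance (N : RightComod k H) [FiniteDimensional k N] : FiniteDimensional k (dual N) :=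
  inferInstanceAs (FiniteDimensional k (Module.Dual k N))

end Comodules

section DualAlgebra

/-- The dual algebra `H^*`, with the convolution product `(f * g)(h) = f(h₁) g(h₂)`. -/
abbrev DualAlg (k H : Type u) [Field k] [Ring H] [HopfAlgebra k H] : Type u :=
  WithConv (H →ₗ[k] k)

variable {k H : Type u} [Field k] [Ring H] [HopfAlgebra k H]

/-- The left `H^*`-module structure `ξ * n = n₀ ξ(n₁)` on a right `H`-comodule. -/
noncomputable abbrev ratModuleStruct (N : RightComod k H) : Module (DualAlg k H) N where
  smul ξ n := TensorProduct.rid k N (ξ.ofConv.lTensor N (N.coact n))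
  one_smul n := by
    have h := LinearMap.congr_fun N.counit_coact n
    exact h
  mul_smul ξ η n := by
    have h := LinearMap.congr_fun N.coassoc n
    simp only [LinearMap.comp_apply] at h
    change TensorProduct.rid k N ((ξ * η).ofConv.lTensor N (N.coact n)) =
      TensorProduct.rid k N (ξ.ofConv.lTensor N (N.coact
        (TensorProduct.rid k N (η.ofConv.lTensor N (N.coact n)))))
    have e1 : (ξ * η).ofConv.lTensor N (N.coact n) =
        (LinearMap.mul' k k ∘ₗ TensorProduct.map ξ.ofConv η.ofConv).lTensor N
          ((comul : H →ₗ[k] H ⊗[k] H).lTensor N (N.coact n)) := by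
      rw [← LinearMap.lTensor_comp_apply, LinearMap.comp_assoc]
      rfl
    rw [e1, ← h]
    generalize N.coact n = y
    induction y with
    | zero => simp
    | add y₁ y₂ h₁ h₂ => simp only [map_add, h₁, h₂]
    | tmul m a =>
      simp only [LinearMap.rTensor_tmul, LinearMap.lTensor_tmul, TensorProduct.rid_tmul, map_smul]
      generalize N.coact m = z
      induction z with
      | zero => simp
      | add z₁ z₂ h₁ h₂ => simp only [map_add, TensorProduct.add_tmul, smul_add, h₁, h₂]
      | tmul p b => simp [smul_smul, mul_comm]
  smul_zero ξ := by
    change TensorProduct.rid k N (ξ.ofConv.lTensor N (N.coact 0)) = 0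
    simp
  zero_smul n := by
    change TensorProduct.rid k N ((0 : H →ₗ[k] k).lTensor N (N.coact n)) = 0
    simp
  smul_add ξ m n := by
    change TensorProduct.rid k N (ξ.ofConv.lTensor N (N.coact (m + n))) = _
    rw [map_add, map_add, map_add]
    rfl
  add_smul ξ η n := by
    change TensorProduct.rid k N ((ξ.ofConv + η.ofConv).lTensor N (N.coact n)) = _
    rw [LinearMap.lTensor_add, LinearMap.add_apply, map_add]
    rfl

/-- A right `H`-comodule regarded as a (rational) left `H^*`-module. -/
noncomputable def ratModule (N : RightComod k H) : ModuleCat.{u} (DualAlg k H) :=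
  letI := ratModuleStruct N
  ModuleCat.of (DualAlg k H) N

/-- For `ξ ∈ H^*` and a linear map `f`, the map `h ↦ ξ(h₁) f(h₂)`. -/
def convAct {X : Type u} [AddCommGroup X] [Module k X] (ξ : H →ₗ[k] k) (f : H →ₗ[k] X) :
    H →ₗ[k] X :=
  (TensorProduct.lid k X).toLinearMap ∘ₗ TensorProduct.map ξ f ∘ₗ comul

theorem convAct_mem (X : RightComod k H) (ξ : H →ₗ[k] k) (f : H →ₗ[k] X)
    (hf : f ∈ homSpace (regular k H) X) : convAct ξ f ∈ homSpace (regular k H) X := by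
  have hf' : X.coact ∘ₗ f = f.rTensor H ∘ₗ comul := hf
  change X.coact ∘ₗ convAct ξ f = (convAct ξ f).rTensor H ∘ₗ comul
  have e1 : X.coact ∘ₗ convAct ξ f = (TensorProduct.lid k (X ⊗[k] H)).toLinearMap ∘ₗ
      TensorProduct.map ξ (X.coact ∘ₗ f) ∘ₗ comul := by
    apply LinearMap.ext
    intro h
    simp only [convAct, LinearMap.comp_apply]
    generalize (comul h : H ⊗[k] H) = y
    induction y with
    | zero => simp
    | add y₁ y₂ h₁ h₂ => simp only [map_add, h₁, h₂]
    | tmul a b => simp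
  have e2 : (TensorProduct.lid k (X ⊗[k] H)).toLinearMap ∘ₗ
      TensorProduct.map ξ (f.rTensor H ∘ₗ comul) ∘ₗ comul =
      (TensorProduct.lid k (X ⊗[k] H)).toLinearMap ∘ₗ
      TensorProduct.map ξ (f.rTensor H) ∘ₗ ((comul : H →ₗ[k] H ⊗[k] H).lTensor H ∘ₗ comul) := by
    rw [← LinearMap.comp_assoc (h := TensorProduct.map ξ (f.rTensor H)),
      LinearMap.map_comp_lTensor]
  rw [e1, hf', e2, ← Coalgebra.coassoc]
  apply LinearMap.ext
  intro h
  simp only [LinearMap.comp_apply]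
  generalize (comul h : H ⊗[k] H) = y
  induction y with
  | zero => simp
  | add y₁ y₂ h₁ h₂ => simp only [map_add, h₁, h₂]
  | tmul a b =>
    simp only [LinearMap.rTensor_tmul, convAct, LinearMap.comp_apply]
    generalize (comul a : H ⊗[k] H) = z
    induction z with
    | zero => simp
    | add z₁ z₂ h₁ h₂ => simp only [map_add, TensorProduct.add_tmul, h₁, h₂]
    | tmul c d => simp [TensorProduct.smul_tmul']

/-- The left `H^*`-module structure `(ξ * f)(h) = ξ(h₁) f(h₂)` on `Hom^H(H, X)`. -/
noncomputable instance homModule (X : RightComod k H) : Module (DualAlg k H) (homSpace (regular k H) X) where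
  smul ξ f := ⟨convAct ξ.ofConv f.1, convAct_mem X _ _ f.2⟩
  one_smul f := by
    apply Subtype.ext
    apply LinearMap.ext
    intro h
    change TensorProduct.lid k X (TensorProduct.map (counit : H →ₗ[k] k) f.1 (comul h)) = f.1 h
    have e : TensorProduct.map (counit : H →ₗ[k] k) f.1 =
        f.1.lTensor k ∘ₗ (counit : H →ₗ[k] k).rTensor H := by
      ext; simp
    rw [e, LinearMap.comp_apply, Coalgebra.rTensor_counit_comul]
    simp
  mul_smul ξ η f := by
    apply Subtype.ext
    change convAct (ξ * η).ofConv f.1 = convAct ξ.ofConv (convAct η.ofConv f.1)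
    have e1 : convAct (ξ * η).ofConv f.1 = (TensorProduct.lid k X).toLinearMap ∘ₗ
        TensorProduct.map (LinearMap.mul' k k ∘ₗ TensorProduct.map ξ.ofConv η.ofConv) f.1 ∘ₗ
          ((TensorProduct.assoc k H H H).symm.toLinearMap ∘ₗ
            (TensorProduct.assoc k H H H).toLinearMap ∘ₗ
              (comul : H →ₗ[k] H ⊗[k] H).rTensor H ∘ₗ comul) := by
      rw [← LinearMap.comp_assoc (f := (comul : H →ₗ[k] H ⊗[k] H).rTensor H ∘ₗ comul),
        LinearEquiv.symm_comp, LinearMap.id_comp,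
        ← LinearMap.comp_assoc (h := TensorProduct.map _ f.1), LinearMap.map_comp_rTensor]
      rfl
    rw [e1, Coalgebra.coassoc]
    apply LinearMap.ext
    intro h
    simp only [convAct, LinearMap.comp_apply]
    generalize (comul h : H ⊗[k] H) = y
    induction y with
    | zero => simp
    | add y₁ y₂ h₁ h₂ => simp only [map_add, h₁, h₂]
    | tmul a b =>
      simp only [LinearMap.lTensor_tmul, TensorProduct.map_tmul, LinearMap.comp_apply]
      generalize (comul b : H ⊗[k] H) = z
      induction z with
      | zero => simp
      | add z₁ z₂ h₁ h₂ => simp only [map_add, TensorProduct.tmul_add, h₁, h₂]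
      | tmul c d => simp [smul_smul, mul_comm]
  smul_zero ξ := by
    apply Subtype.ext
    change convAct ξ.ofConv 0 = 0
    simp [convAct]
  zero_smul f := by
    apply Subtype.ext
    change convAct 0 f.1 = 0
    simp [convAct]
  smul_add ξ f g := by
    apply Subtype.ext
    change convAct ξ.ofConv (f.1 + g.1) = convAct ξ.ofConv f.1 + convAct ξ.ofConv g.1
    simp only [convAct, TensorProduct.map_add_right, LinearMap.add_comp, LinearMap.comp_add]
  add_smul ξ η f := by
    apply Subtype.ext
    change convAct (ξ.ofConv + η.ofConv) f.1 = convAct ξ.ofConv f.1 + convAct η.ofConv f.1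
    simp only [convAct, TensorProduct.map_add_left, LinearMap.add_comp, LinearMap.comp_add]

variable (k H) in
/-- The functor `T : Comod-H ⥤ H^*-Mod`, `X ↦ Hom^H(H, X)`. -/
noncomputable def homFunctor : RightComod k H ⥤ ModuleCat.{u} (DualAlg k H) where
  obj X := ModuleCat.of (DualAlg k H) (homSpace (regular k H) X)
  map {X Y} g := ModuleCat.ofHom
    { toFun := fun f : homSpace (regular k H) X => (CategoryStruct.comp (X := regular k H) f g :)
      map_add' := fun f₁ f₂ => Subtype.ext (LinearMap.comp_add _ _ g.1)
      map_smul' := fun ξ f => by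
        apply Subtype.ext
        change g.1 ∘ₗ convAct ξ.ofConv f.1 = convAct ξ.ofConv (g.1 ∘ₗ f.1)
        apply LinearMap.ext
        intro h
        simp only [convAct, LinearMap.comp_apply]
        generalize (comul h : H ⊗[k] H) = y
        induction y with
        | zero => simp
        | add y₁ y₂ h₁ h₂ => simp only [map_add, h₁, h₂]
        | tmul a b => simp }

end DualAlgebra

section Integrals

variable (k H : Type u) [Field k] [Ring H] [HopfAlgebra k H]

/-- Right integrals: functionals `χ` with `χ(a₁) a₂ = χ(a) 1`. -/
def rightIntegrals : Submodule k (H →ₗ[k] k) where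
  carrier := {χ | ∀ a : H, TensorProduct.lid k H (χ.rTensor H (comul a)) = χ a • 1}
  add_mem' {f g} hf hg a := by
    rw [LinearMap.rTensor_add, LinearMap.add_apply, map_add, hf a, hg a, LinearMap.add_apply,
      add_smul]
  zero_mem' a := by simp
  smul_mem' c f hf a := by
    rw [LinearMap.rTensor_smul, LinearMap.smul_apply, map_smul, hf a, LinearMap.smul_apply,
      smul_assoc]

/-- Left integrals: functionals `φ` with `a₁ φ(a₂) = φ(a) 1`. -/
def leftIntegrals : Submodule k (H →ₗ[k] k) where
  carrier := {φ | ∀ a : H, TensorProduct.rid k H (φ.lTensor H (comul a)) = φ a • 1}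
  add_mem' {f g} hf hg a := by
    rw [LinearMap.lTensor_add, LinearMap.add_apply, map_add, hf a, hg a, LinearMap.add_apply,
      add_smul]
  zero_mem' a := by simp
  smul_mem' c f hf a := by
    rw [LinearMap.lTensor_smul, LinearMap.smul_apply, map_smul, hf a, LinearMap.smul_apply,
      smul_assoc]

variable {k H} in
/-- The comodule `Γ` with underlying space the right integrals and coaction `χ ↦ χ ⊗ γ`, for a
group-like element `γ`. -/
def integralComod (γ : H) (hγ : IsGroupLikeElem k γ) : RightComod k H where
  carrier := rightIntegrals k H
  coact := (TensorProduct.mk k (rightIntegrals k H) H).flip γ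
  coassoc := by
    apply LinearMap.ext
    intro χ
    simp [hγ.comul_eq_tmul_self]
  counit_coact := by
    apply LinearMap.ext
    intro χ
    simp [hγ.counit_eq_one]

instance (γ : H) (hγ : IsGroupLikeElem k γ) [h : FiniteDimensional k (rightIntegrals k H)] :
    FiniteDimensional k (integralComod γ hγ) := h

end Integrals

end HopfComod

/-! Fix a non-zero right integral `χ`. Everything rests on the form `(x, y) ↦ χ(xy)`. Its radicals
are one-sided ideals stable under one leg of the comultiplication, and a proper ideal of this kind
is zero, so the form is non-degenerate. The same argument for `χ(S(x)y)` shows that the antipode `S`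
is injective, and a density argument shows that it is surjective. Strong invariance of integrals
then gives their uniqueness up to scalars, and uniqueness forces `a₁ χ(a₂) = χ(a) γ` with `γ`
group-like.

The map `b ↦ S²(b)γ` is a coalgebra automorphism; let `κ` be its inverse and put `B(a, h) = χ(S(κ a)
h)`. Invariance of `χ` on both sides yields `B(a, h₁) h₂ = κ(a₁) B(a₂, h)` and `h₁ B(a, h₂) = B(a₁,
h) a₂` (`exists_twistedPairing`). Let `N^κ` be `N` with coaction `n₀ ⊗ κ(n₁)`. By the first identity
`h ↦ n₀ B(n₁, h)` is a comodule map `H → N^κ`; by the second its dependence on `n` is `H^*`-linear.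
Non-degeneracy makes the resulting map `N → T(N^κ)` universal (`exists_factor`), hence `U(N) ≅ N^κ`
for every left adjoint `U` (`nonempty_iso_pushforward`), whatever the dimension of `N`.

For finite-dimensional `N`, the double dual twists the coaction by `S²`, and `S²(κ a) = a γ⁻¹`. So
`U(N)^{**}` is `N` with coaction `n₀ ⊗ n₁ γ⁻¹`, which is `N ⊗ Γ^*`. The left adjoint exists because
`H ⊗_{H^*} M` represents `Hom(M, T(-))`; this needs no integral. -/

namespace HopfComod

/-! ### Slices of tensors, and density of separating families of functionals. -/

section Slices

variable {k H : Type u} [Field k] [Ring H] [HopfAlgebra k H]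

/-- `t` lies in the image of `V ⊗ ker B` as soon as all slices of `t` along `B` vanish. -/
theorem mem_range_lTensor_ker {V W Y : Type u} [AddCommGroup V] [Module k V] [AddCommGroup W]
    [Module k W] (B : W →ₗ[k] Y → k) (t : V ⊗[k] W)
    (h : ∀ y, TensorProduct.rid k V ((LinearMap.proj y ∘ₗ B).lTensor V t) = 0) :
    t ∈ LinearMap.range ((LinearMap.ker B).subtype.lTensor V) := by
  classical
  let b := Module.Basis.ofVectorSpace k V
  obtain ⟨c, rfl⟩ := TensorProduct.eq_repr_basis_left b t
  refine Submodule.sum_mem _ fun i _ => ?_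
  have hc : c i ∈ LinearMap.ker B := by
    rw [LinearMap.mem_ker]
    funext y
    have h1 := h y
    rw [Finsupp.sum, map_sum, map_sum] at h1
    simp only [LinearMap.lTensor_tmul, TensorProduct.rid_tmul, LinearMap.comp_apply,
      LinearMap.proj_apply] at h1
    by_cases hi : i ∈ c.support
    · exact linearIndependent_iff'.1 b.linearIndependent c.support (fun j => B (c j) y) h1 i hi
    · rw [Finsupp.notMem_support_iff.1 hi, map_zero]
  exact ⟨b i ⊗ₜ ⟨c i, hc⟩, by simp⟩

/-- Expand the free leg in a basis: a vanishing slice kills every coefficient, so each coefficient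
lies in `ker B`. -/
theorem mem_range_rTensor_ker {V W Y : Type u} [AddCommGroup V] [Module k V] [AddCommGroup W]
    [Module k W] (B : W →ₗ[k] Y → k) (t : W ⊗[k] V)
    (h : ∀ y, TensorProduct.lid k V ((LinearMap.proj y ∘ₗ B).rTensor V t) = 0) :
    t ∈ LinearMap.range ((LinearMap.ker B).subtype.rTensor V) := by
  classical
  let b := Module.Basis.ofVectorSpace k V
  obtain ⟨c, rfl⟩ := TensorProduct.eq_repr_basis_right b t
  refine Submodule.sum_mem _ fun i _ => ?_
  have hc : c i ∈ LinearMap.ker B := by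
    rw [LinearMap.mem_ker]
    funext y
    have h1 := h y
    rw [Finsupp.sum, map_sum, map_sum] at h1
    simp only [LinearMap.rTensor_tmul, TensorProduct.lid_tmul, LinearMap.comp_apply,
      LinearMap.proj_apply] at h1
    by_cases hi : i ∈ c.support
    · exact linearIndependent_iff'.1 b.linearIndependent c.support (fun j => B (c j) y) h1 i hi
    · rw [Finsupp.notMem_support_iff.1 hi, map_zero]
  exact ⟨⟨c i, hc⟩ ⊗ₜ b i, by simp⟩

/-- Density: functionals from a family separating points approximate any functional on a
finite-dimensional subspace. -/
theorem exists_eq_on_finset {W Y : Type u} [AddCommGroup W] [Module k W] [AddCommGroup Y]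
    [Module k Y] (B : W →ₗ[k] Y →ₗ[k] k) (hB : ∀ x, (∀ y, B x y = 0) → x = 0)
    (ξ : W →ₗ[k] k) (s : Finset W) : ∃ y, ∀ x ∈ s, B x y = ξ x := by
  let D := Submodule.span k (s : Set W)
  have : FiniteDimensional k D := FiniteDimensional.span_finset k s
  have hinj : Function.Injective (B ∘ₗ D.subtype) := by
    rw [injective_iff_map_eq_zero]
    intro x hx
    exact Subtype.ext (hB x fun y => LinearMap.congr_fun hx y)
  obtain ⟨y, hy⟩ := (LinearMap.flip_surjective_iff₁ (B := B ∘ₗ D.subtype)).2 hinj (ξ ∘ₗ D.subtype)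
  exact ⟨y, fun x hx => LinearMap.congr_fun hy ⟨x, Submodule.subset_span hx⟩⟩

/-- A tensor involves finitely many elements of `W`, so density applies. With `ξ` the counit, this
lets integrals imitate the counit on any given tensor. -/
theorem exists_slice_eq {V W Y : Type u} [AddCommGroup V] [Module k V] [AddCommGroup W]
    [Module k W] [AddCommGroup Y] [Module k Y] (B : W →ₗ[k] Y →ₗ[k] k)
    (hB : ∀ x, (∀ y, B x y = 0) → x = 0) (ξ : W →ₗ[k] k) (t : V ⊗[k] W) :
    ∃ y, (B.flip y).lTensor V t = ξ.lTensor V t := by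
  classical
  obtain ⟨s, hs⟩ := TensorProduct.exists_finset t
  obtain ⟨y, hy⟩ := exists_eq_on_finset B hB ξ (s.image Prod.snd)
  refine ⟨y, ?_⟩
  rw [hs, map_sum, map_sum]
  refine Finset.sum_congr rfl fun i hi => ?_
  rw [LinearMap.lTensor_tmul, LinearMap.lTensor_tmul, LinearMap.flip_apply,
    hy _ (Finset.mem_image_of_mem _ hi)]

theorem exists_slice_eq' {V W Y : Type u} [AddCommGroup V] [Module k V] [AddCommGroup W]
    [Module k W] [AddCommGroup Y] [Module k Y] (B : W →ₗ[k] Y →ₗ[k] k)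
    (hB : ∀ x, (∀ y, B x y = 0) → x = 0) (ξ : W →ₗ[k] k) (t : W ⊗[k] V) :
    ∃ y, (B.flip y).rTensor V t = ξ.rTensor V t := by
  classical
  obtain ⟨s, hs⟩ := TensorProduct.exists_finset t
  obtain ⟨y, hy⟩ := exists_eq_on_finset B hB ξ (s.image Prod.fst)
  refine ⟨y, ?_⟩
  rw [hs, map_sum, map_sum]
  refine Finset.sum_congr rfl fun i hi => ?_
  rw [LinearMap.rTensor_tmul, LinearMap.rTensor_tmul, LinearMap.flip_apply,
    hy _ (Finset.mem_image_of_mem _ hi)]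

/-- The slice `a ⊗ b ↦ χ(a) b`. -/
def sliceLeft (χ : H →ₗ[k] k) : H ⊗[k] H →ₗ[k] H :=
  (TensorProduct.lid k H).toLinearMap ∘ₗ χ.rTensor H

/-- The slice `a ⊗ b ↦ φ(b) a`. -/
def sliceRight (φ : H →ₗ[k] k) : H ⊗[k] H →ₗ[k] H :=
  (TensorProduct.rid k H).toLinearMap ∘ₗ φ.lTensor H

@[simp] theorem sliceLeft_tmul (χ : H →ₗ[k] k) (a b : H) : sliceLeft χ (a ⊗ₜ b) = χ a • b := by
  simp [sliceLeft]

@[simp] theorem sliceRight_tmul (φ : H →ₗ[k] k) (a b : H) : sliceRight φ (a ⊗ₜ b) = φ b • a := by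
  simp [sliceRight]

theorem sliceLeft_mul_tmul (χ : H →ₗ[k] k) (t : H ⊗[k] H) (c : H) :
    sliceLeft χ (t * 1 ⊗ₜ c) = sliceLeft χ t * c := by
  induction t with
  | zero => simp
  | add x y hx hy => simp only [add_mul, map_add, hx, hy]
  | tmul a b => simp

theorem sliceLeft_tmul_mul (χ : H →ₗ[k] k) (t : H ⊗[k] H) (c : H) :
    sliceLeft χ (1 ⊗ₜ c * t) = c * sliceLeft χ t := by
  induction t with
  | zero => simp
  | add x y hx hy => simp only [mul_add, map_add, hx, hy]
  | tmul a b => simp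

theorem sliceRight_tmul_mul (φ : H →ₗ[k] k) (t : H ⊗[k] H) (c : H) :
    sliceRight φ (c ⊗ₜ 1 * t) = c * sliceRight φ t := by
  induction t with
  | zero => simp
  | add x y hx hy => simp only [mul_add, map_add, hx, hy]
  | tmul a b => simp

theorem sliceRight_mul_tmul (φ : H →ₗ[k] k) (t : H ⊗[k] H) (c : H) :
    sliceRight φ (t * c ⊗ₜ 1) = sliceRight φ t * c := by
  induction t with
  | zero => simp
  | add x y hx hy => simp only [add_mul, map_add, hx, hy]
  | tmul a b => simp

theorem sliceLeft_counit_comul (a : H) : sliceLeft (counit : H →ₗ[k] k) (comul a) = a := by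
  simp [sliceLeft]

theorem sliceRight_counit_comul (a : H) : sliceRight (counit : H →ₗ[k] k) (comul a) = a := by
  simp [sliceRight]

theorem mem_rightIntegrals {χ : H →ₗ[k] k} :
    χ ∈ rightIntegrals k H ↔ ∀ a, sliceLeft χ (comul a) = χ a • 1 := Iff.rfl

theorem mem_leftIntegrals {φ : H →ₗ[k] k} :
    φ ∈ leftIntegrals k H ↔ ∀ a, sliceRight φ (comul a) = φ a • 1 := Iff.rfl

end Slices

/-! ### Convolution identities and strong invariance of integrals. -/

section Convolution

variable {k H : Type u} [Field k] [Ring H] [HopfAlgebra k H]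

open WithConv

/-- Composing with an algebra map preserves convolution products, so `S * id = 1` is carried to any
target algebra; the targets of interest are `H ⊗ H` with its embeddings and `Δ` itself. -/
theorem algHom_comp_antipode_mul {A : Type u} [Ring A] [Algebra k A] (i : H →ₐ[k] A) :
    toConv (i.toLinearMap ∘ₗ antipode k (A := H)) * toConv i.toLinearMap =
      (1 : WithConv (H →ₗ[k] A)) := by
  have h := LinearMap.algHom_comp_convMul_distrib i (toConv (antipode k (A := H)))
    (toConv LinearMap.id)
  rw [LinearMap.antipode_mul_id] at h
  apply WithConv.ext
  rw [LinearMap.comp_id] at h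
  exact h.symm.trans (by ext x; simp [LinearMap.convOne_def])

theorem mul_algHom_comp_antipode {A : Type u} [Ring A] [Algebra k A] (i : H →ₐ[k] A) :
    toConv i.toLinearMap * toConv (i.toLinearMap ∘ₗ antipode k (A := H)) =
      (1 : WithConv (H →ₗ[k] A)) := by
  have h := LinearMap.algHom_comp_convMul_distrib i (toConv LinearMap.id)
    (toConv (antipode k (A := H)))
  rw [LinearMap.id_mul_antipode] at h
  apply WithConv.ext
  rw [LinearMap.comp_id] at h
  exact h.symm.trans (by ext x; simp [LinearMap.convOne_def])

variable (k H) in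
/-- The embedding `a ↦ a ⊗ 1`. -/
abbrev inclL : H →ₐ[k] H ⊗[k] H := Algebra.TensorProduct.includeLeft

variable (k H) in
/-- The embedding `a ↦ 1 ⊗ a`. -/
abbrev inclR : H →ₐ[k] H ⊗[k] H := Algebra.TensorProduct.includeRight

theorem inclL_mul_inclR : toConv (inclL k H).toLinearMap * toConv (inclR k H).toLinearMap =
    toConv (comul : H →ₗ[k] H ⊗[k] H) := by
  ext c
  rw [(ℛ k c).convMul_apply]
  conv_rhs => simp only [WithConv.ofConv_toConv]
  rw [← (ℛ k c).eq]
  simp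

/-- `a₁ ⊗ a₂ S(a₃) = a ⊗ 1`. -/
theorem sum_comul_mul_antipode {a : H} {ι : Type*} (r : Repr k a ι) :
    ∑ i ∈ r.index, comul (R := k) (r.left i) * (1 ⊗ₜ antipode k (r.right i)) = a ⊗ₜ[k] (1 : H) := by
  have h : toConv (comul : H →ₗ[k] H ⊗[k] H) *
      toConv ((inclR k H).toLinearMap ∘ₗ antipode k) = toConv (inclL k H).toLinearMap := by
    rw [← inclL_mul_inclR, mul_assoc, mul_algHom_comp_antipode, mul_one]
  have h' := congrArg (fun f : WithConv (H →ₗ[k] H ⊗[k] H) => f a) h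
  simp only [r.convMul_apply] at h'
  exact h'

/-- `S(a₁) a₂ ⊗ a₃ = 1 ⊗ a`. -/
theorem sum_antipode_mul_comul {a : H} {ι : Type*} (r : Repr k a ι) :
    ∑ i ∈ r.index, (antipode k (r.left i) ⊗ₜ 1) * comul (R := k) (r.right i) = (1 : H) ⊗ₜ[k] a := by
  have h : toConv ((inclL k H).toLinearMap ∘ₗ antipode k) *
      toConv (comul : H →ₗ[k] H ⊗[k] H) = toConv (inclR k H).toLinearMap := by
    rw [← inclL_mul_inclR, ← mul_assoc, algHom_comp_antipode_mul, one_mul]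
  have h' := congrArg (fun f : WithConv (H →ₗ[k] H ⊗[k] H) => f a) h
  simp only [r.convMul_apply] at h'
  exact h'

/-- `S(a₃) ⊗ a₁ S(a₂) = S(a) ⊗ 1`. -/
theorem sum_mul_comul_antipode {a : H} {ι : Type*} (r : Repr k a ι) :
    ∑ i ∈ r.index, (1 ⊗ₜ r.left i) * comul (R := k) (antipode k (r.right i)) =
      antipode k a ⊗ₜ[k] (1 : H) := by
  have h : toConv (inclR k H).toLinearMap *
      toConv ((comul : H →ₗ[k] H ⊗[k] H) ∘ₗ antipode k) =
      toConv ((inclL k H).toLinearMap ∘ₗ antipode k) := by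
    have h1 : toConv (comul : H →ₗ[k] H ⊗[k] H) *
        toConv ((comul : H →ₗ[k] H ⊗[k] H) ∘ₗ antipode k) = 1 :=
      mul_algHom_comp_antipode (Bialgebra.comulAlgHom k H)
    -- Insert `(inclL ∘ S) * inclL = 1` on the left, so that `inclL * inclR = Δ` meets its
    -- convolution inverse `Δ ∘ S`.
    rw [← one_mul (toConv (inclR k H).toLinearMap), ← algHom_comp_antipode_mul (inclL k H),
      mul_assoc, mul_assoc, ← mul_assoc (toConv (inclL k H).toLinearMap), inclL_mul_inclR, h1,
      mul_one]
  have h' := congrArg (fun f : WithConv (H →ₗ[k] H ⊗[k] H) => f a) h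
  simp only [r.convMul_apply] at h'
  exact h'

/-- `S(a₂) a₃ ⊗ S(a₁) = 1 ⊗ S(a)`. -/
theorem sum_comul_antipode_mul {a : H} {ι : Type*} (r : Repr k a ι) :
    ∑ i ∈ r.index, comul (R := k) (antipode k (r.left i)) * (r.right i ⊗ₜ 1) =
      (1 : H) ⊗ₜ[k] antipode k a := by
  have h : toConv ((comul : H →ₗ[k] H ⊗[k] H) ∘ₗ antipode k) * toConv (inclL k H).toLinearMap =
      toConv ((inclR k H).toLinearMap ∘ₗ antipode k) := by
    have h1 : toConv ((comul : H →ₗ[k] H ⊗[k] H) ∘ₗ antipode k) *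
        toConv (comul : H →ₗ[k] H ⊗[k] H) = 1 :=
      algHom_comp_antipode_mul (Bialgebra.comulAlgHom k H)
    rw [← mul_one (toConv (inclL k H).toLinearMap), ← mul_algHom_comp_antipode (inclR k H),
      ← mul_assoc (toConv (inclL k H).toLinearMap), inclL_mul_inclR, ← mul_assoc, h1, one_mul]
  have h' := congrArg (fun f : WithConv (H →ₗ[k] H ⊗[k] H) => f a) h
  simp only [r.convMul_apply] at h'
  exact h'

/-- Strong invariance: replace `g ⊗ 1` by `g₁ ⊗ g₂ S(g₃)`, combine `Δ(h) Δ(g₁) = Δ(h g₁)`, and apply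
the integral property. The next three lemmas are the mirror images. -/
theorem sliceLeft_comul_mul {χ : H →ₗ[k] k} (hχ : χ ∈ rightIntegrals k H) (h : H) {g : H}
    {ι : Type*} (r : Repr k g ι) : sliceLeft χ (comul h * g ⊗ₜ 1) =
      ∑ i ∈ r.index, χ (h * r.left i) • antipode k (r.right i) := by
  rw [← sum_comul_mul_antipode r, Finset.mul_sum, map_sum]
  refine Finset.sum_congr rfl fun i _ => ?_
  rw [← mul_assoc, sliceLeft_mul_tmul, ← Bialgebra.comul_mul, mem_rightIntegrals.1 hχ, smul_mul_assoc,
    one_mul]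

theorem sliceLeft_antipode_mul_comul {χ : H →ₗ[k] k} (hχ : χ ∈ rightIntegrals k H) (h : H) {g : H}
    {ι : Type*} (r : Repr k g ι) : sliceLeft χ (antipode k g ⊗ₜ 1 * comul h) =
      ∑ i ∈ r.index, χ (antipode k (r.right i) * h) • r.left i := by
  rw [← sum_mul_comul_antipode r, Finset.sum_mul, map_sum]
  refine Finset.sum_congr rfl fun i _ => ?_
  rw [mul_assoc, sliceLeft_tmul_mul, ← Bialgebra.comul_mul, mem_rightIntegrals.1 hχ, mul_smul_comm,
    mul_one]

theorem sliceRight_comul_mul_antipode {φ : H →ₗ[k] k} (hφ : φ ∈ leftIntegrals k H) (h : H) {g : H}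
    {ι : Type*} (r : Repr k g ι) : sliceRight φ (comul h * 1 ⊗ₜ antipode k g) =
      ∑ i ∈ r.index, φ (h * antipode k (r.left i)) • r.right i := by
  rw [← sum_comul_antipode_mul r, Finset.mul_sum, map_sum]
  refine Finset.sum_congr rfl fun i _ => ?_
  rw [← mul_assoc, sliceRight_mul_tmul, ← Bialgebra.comul_mul, mem_leftIntegrals.1 hφ,
    smul_mul_assoc, one_mul]

/-- The element `c` is kept general: `c = 1` covers left integrals, and `c = γ` covers a right
integral sliced on its other side. -/
theorem sliceRight_mul_comul {φ : H →ₗ[k] k} {c : H}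
    (hφ : ∀ a, sliceRight φ (comul a) = φ a • c) (h : H) {g : H}
    {ι : Type*} (r : Repr k g ι) : sliceRight φ (1 ⊗ₜ g * comul h) =
      ∑ i ∈ r.index, φ (r.right i * h) • (antipode k (r.left i) * c) := by
  rw [← sum_antipode_mul_comul r, Finset.sum_mul, map_sum]
  refine Finset.sum_congr rfl fun i _ => ?_
  rw [mul_assoc, sliceRight_tmul_mul, ← Bialgebra.comul_mul, hφ, mul_smul_comm]

end Convolution

/-! ### Non-degeneracy of integrals and bijectivity of the antipode. -/

section Nondegenerate

variable {k H : Type u} [Field k] [Ring H] [HopfAlgebra k H]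

/-- A proper left ideal that is a left coideal in the strong sense `Δ K ⊆ H ⊗ K` vanishes. -/
theorem eq_bot_of_comul_mem_lTensor (K : Submodule k H) (hK : ∀ a, ∀ h ∈ K, a * h ∈ K)
    (hΔ : ∀ h ∈ K, comul (R := k) h ∈ LinearMap.range (K.subtype.lTensor H))
    (h1 : (1 : H) ∉ K) : K = ⊥ := by
  -- For `h ∈ K`, `ε(h) 1 = S(h₁) h₂` lies in `K`, so `ε(h) = 0` as `1 ∉ K`. Then `h = h₁ ε(h₂) =
  -- 0`, because the second leg stays in `K`.
  have hε : ∀ h ∈ K, counit (R := k) h = 0 := by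
    intro h hh
    by_contra hne
    apply h1
    obtain ⟨t, ht⟩ := hΔ h hh
    have h2 : ∀ t : H ⊗[k] K,
        LinearMap.mul' k H ((antipode k).rTensor H (K.subtype.lTensor H t)) ∈ K := by
      intro t
      induction t with
      | zero => simp
      | add x y hx hy => simpa only [map_add] using K.add_mem hx hy
      | tmul a b => simpa using hK (antipode k a) b b.2
    have h3 := h2 t
    rw [ht, mul_antipode_rTensor_comul_apply, Algebra.algebraMap_eq_smul_one] at h3
    exact (K.smul_mem_iff hne).1 h3
  rw [eq_bot_iff]
  intro h hh
  obtain ⟨t, ht⟩ := hΔ h hh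
  have h2 : (counit : H →ₗ[k] k) ∘ₗ K.subtype = 0 := LinearMap.ext fun x => hε x x.2
  have h3 := sliceRight_counit_comul (k := k) h
  rw [← ht, sliceRight, LinearMap.comp_apply, ← LinearMap.lTensor_comp_apply, h2] at h3
  simpa using h3.symm

theorem eq_bot_of_comul_mem_rTensor (K : Submodule k H) (hK : ∀ a, ∀ h ∈ K, h * a ∈ K)
    (hΔ : ∀ h ∈ K, comul (R := k) h ∈ LinearMap.range (K.subtype.rTensor H))
    (h1 : (1 : H) ∉ K) : K = ⊥ := by
  have hε : ∀ h ∈ K, counit (R := k) h = 0 := by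
    intro h hh
    by_contra hne
    apply h1
    obtain ⟨t, ht⟩ := hΔ h hh
    have h2 : ∀ t : K ⊗[k] H,
        LinearMap.mul' k H ((antipode k).lTensor H (K.subtype.rTensor H t)) ∈ K := by
      intro t
      induction t with
      | zero => simp
      | add x y hx hy => simpa only [map_add] using K.add_mem hx hy
      | tmul a b => simpa using hK (antipode k b) a a.2
    have h3 := h2 t
    rw [ht, mul_antipode_lTensor_comul_apply, Algebra.algebraMap_eq_smul_one] at h3
    exact (K.smul_mem_iff hne).1 h3
  rw [eq_bot_iff]
  intro h hh
  obtain ⟨t, ht⟩ := hΔ h hh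
  have h2 : (counit : H →ₗ[k] k) ∘ₗ K.subtype = 0 := LinearMap.ext fun x => hε x x.2
  have h3 := sliceLeft_counit_comul (k := k) h
  rw [← ht, sliceLeft, LinearMap.comp_apply, ← LinearMap.rTensor_comp_apply, h2] at h3
  simpa using h3.symm

/-- The bilinear form `(x, y) ↦ f (x y)`. -/
def mulForm (f : H →ₗ[k] k) : H →ₗ[k] H →ₗ[k] k := (LinearMap.mul k H).compr₂ f

@[simp] theorem mulForm_apply (f : H →ₗ[k] k) (x y : H) : mulForm f x y = f (x * y) := rfl

/-- Linear functionals as functions. -/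
def formFun {Y : Type u} [AddCommGroup Y] [Module k Y] (B : H →ₗ[k] Y →ₗ[k] k) :
    H →ₗ[k] Y → k := LinearMap.ltoFun k Y k k ∘ₗ B

theorem mem_ker_formFun {Y : Type u} [AddCommGroup Y] [Module k Y] {B : H →ₗ[k] Y →ₗ[k] k}
    {x : H} : x ∈ LinearMap.ker (formFun B) ↔ ∀ y, B x y = 0 :=
  ⟨fun h y => congrFun h y, fun h => funext h⟩

theorem sliceLeft_mulRight (χ : H →ₗ[k] k) (g : H) (t : H ⊗[k] H) :
    sliceLeft (χ ∘ₗ LinearMap.mulRight k g) t = sliceLeft χ (t * g ⊗ₜ 1) := by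
  induction t with
  | zero => simp
  | add x y hx hy => simp only [map_add, add_mul, hx, hy]
  | tmul a b => simp

theorem sliceLeft_mulLeft (χ : H →ₗ[k] k) (g : H) (t : H ⊗[k] H) :
    sliceLeft (χ ∘ₗ LinearMap.mulLeft k g) t = sliceLeft χ (g ⊗ₜ 1 * t) := by
  induction t with
  | zero => simp
  | add x y hx hy => simp only [map_add, mul_add, hx, hy]
  | tmul a b => simp

theorem sliceRight_mulLeft (φ : H →ₗ[k] k) (g : H) (t : H ⊗[k] H) :
    sliceRight (φ ∘ₗ LinearMap.mulLeft k g) t = sliceRight φ (1 ⊗ₜ g * t) := by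
  induction t with
  | zero => simp
  | add x y hx hy => simp only [map_add, mul_add, hx, hy]
  | tmul a b => simp

theorem sliceRight_mulRight (φ : H →ₗ[k] k) (g : H) (t : H ⊗[k] H) :
    sliceRight (φ ∘ₗ LinearMap.mulRight k g) t = sliceRight φ (t * 1 ⊗ₜ g) := by
  induction t with
  | zero => simp
  | add x y hx hy => simp only [map_add, add_mul, hx, hy]
  | tmul a b => simp

/-- The radical is a right ideal, and strong invariance `χ(h₁ g) h₂ = χ(h g₁) S(g₂)` makes all
slices of `Δ h` vanish for `h` in it. It omits `1` since `χ ≠ 0`. -/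
theorem eq_zero_of_rightIntegral_mul {χ : H →ₗ[k] k} (hχ : χ ∈ rightIntegrals k H) (h0 : χ ≠ 0)
    {x : H} (hx : ∀ g, χ (x * g) = 0) : x = 0 := by
  have hK := eq_bot_of_comul_mem_rTensor (LinearMap.ker (formFun (mulForm χ))) ?_ ?_ ?_
  · exact (Submodule.eq_bot_iff _).1 hK x (mem_ker_formFun.2 hx)
  · intro a h hh
    rw [mem_ker_formFun] at hh ⊢
    intro y
    rw [mulForm_apply, mul_assoc]
    exact hh _
  · intro h hh
    apply mem_range_rTensor_ker
    intro g
    refine (sliceLeft_mulRight χ g (comul h)).trans ?_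
    rw [sliceLeft_comul_mul hχ h (ℛ k g)]
    exact Finset.sum_eq_zero fun i _ => by
      rw [mem_ker_formFun] at hh
      rw [← mulForm_apply, hh, zero_smul]
  · intro h
    rw [mem_ker_formFun] at h
    exact h0 (LinearMap.ext fun y => by simpa using h y)

theorem eq_zero_of_mul_quasiIntegral {φ : H →ₗ[k] k} {c : H}
    (hφ : ∀ a, sliceRight φ (comul a) = φ a • c) (h0 : φ ≠ 0)
    {x : H} (hx : ∀ g, φ (g * x) = 0) : x = 0 := by
  have hK := eq_bot_of_comul_mem_lTensor (LinearMap.ker (formFun (mulForm φ).flip)) ?_ ?_ ?_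
  · exact (Submodule.eq_bot_iff _).1 hK x (mem_ker_formFun.2 hx)
  · intro a h hh
    rw [mem_ker_formFun] at hh ⊢
    intro y
    rw [LinearMap.flip_apply, mulForm_apply, ← mul_assoc]
    exact hh _
  · intro h hh
    apply mem_range_lTensor_ker
    intro g
    refine (sliceRight_mulLeft φ g (comul h)).trans ?_
    rw [sliceRight_mul_comul hφ h (ℛ k g)]
    exact Finset.sum_eq_zero fun i _ => by
      rw [mem_ker_formFun] at hh
      rw [← mulForm_apply, ← LinearMap.flip_apply, hh, zero_smul]
  · intro h
    rw [mem_ker_formFun] at h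
    exact h0 (LinearMap.ext fun y => by simpa using h y)

/-- Same radical argument, now with `h₁ χ(S(h₂) g) = χ(S(h) g₁) g₂`; since `S` reverses products,
the radical is a left ideal. Injectivity of `S` follows at once. -/
theorem eq_zero_of_rightIntegral_antipode_mul {χ : H →ₗ[k] k} (hχ : χ ∈ rightIntegrals k H)
    (h0 : χ ≠ 0) {x : H} (hx : ∀ g, χ (antipode k x * g) = 0) : x = 0 := by
  have hK := eq_bot_of_comul_mem_lTensor
    (LinearMap.ker (formFun (mulForm χ ∘ₗ antipode k))) ?_ ?_ ?_
  · exact (Submodule.eq_bot_iff _).1 hK x (mem_ker_formFun.2 hx)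
  · intro a h hh
    rw [mem_ker_formFun] at hh ⊢
    intro y
    rw [LinearMap.comp_apply, mulForm_apply, antipode_mul_antidistrib, mul_assoc]
    exact hh _
  · intro h hh
    rw [mem_ker_formFun] at hh
    apply mem_range_lTensor_ker
    intro g
    have h2 : ∑ i ∈ (ℛ k h).index,
        χ (antipode k ((ℛ k h).right i) * g) • (ℛ k h).left i = 0 := by
      rw [← sliceLeft_antipode_mul_comul hχ g (ℛ k h), ← sliceLeft_mulLeft]
      have h3 : χ ∘ₗ LinearMap.mulLeft k (antipode k h) = 0 := LinearMap.ext hh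
      simp [h3, sliceLeft]
    rw [← (ℛ k h).eq, map_sum, map_sum]
    refine Eq.trans (Finset.sum_congr rfl fun i _ => ?_) h2
    simp [formFun]
  · intro h
    rw [mem_ker_formFun] at h
    exact h0 (LinearMap.ext fun y => by simpa using h y)

theorem antipode_injective {χ : H →ₗ[k] k} (hχ : χ ∈ rightIntegrals k H) (h0 : χ ≠ 0) :
    Function.Injective (antipode k (A := H)) := by
  rw [injective_iff_map_eq_zero]
  intro x hx
  exact eq_zero_of_rightIntegral_antipode_mul hχ h0 fun g => by simp [hx]

theorem eq_zero_of_leftIntegral_mul_antipode {φ : H →ₗ[k] k} (hφ : φ ∈ leftIntegrals k H)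
    (h0 : φ ≠ 0) {x : H} (hx : ∀ g, φ (g * antipode k x) = 0) : x = 0 := by
  have hK := eq_bot_of_comul_mem_rTensor
    (LinearMap.ker (formFun ((mulForm φ).flip ∘ₗ antipode k))) ?_ ?_ ?_
  · exact (Submodule.eq_bot_iff _).1 hK x (mem_ker_formFun.2 hx)
  · intro a h hh
    rw [mem_ker_formFun] at hh ⊢
    intro y
    rw [LinearMap.comp_apply, LinearMap.flip_apply, mulForm_apply, antipode_mul_antidistrib,
      ← mul_assoc]
    exact hh _
  · intro h hh
    rw [mem_ker_formFun] at hh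
    apply mem_range_rTensor_ker
    intro g
    have h2 : ∑ i ∈ (ℛ k h).index,
        φ (g * antipode k ((ℛ k h).left i)) • (ℛ k h).right i = 0 := by
      rw [← sliceRight_comul_mul_antipode hφ g (ℛ k h), ← sliceRight_mulRight]
      have h3 : φ ∘ₗ LinearMap.mulRight k (antipode k h) = 0 := LinearMap.ext hh
      simp [h3, sliceRight]
    rw [← (ℛ k h).eq, map_sum, map_sum]
    refine Eq.trans (Finset.sum_congr rfl fun i _ => ?_) h2
    simp [formFun]
  · intro h
    rw [mem_ker_formFun] at h
    exact h0 (LinearMap.ext fun y => by simpa using h y)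

theorem antipode_injective_of_left {φ : H →ₗ[k] k} (hφ : φ ∈ leftIntegrals k H) (h0 : φ ≠ 0) :
    Function.Injective (antipode k (A := H)) := by
  rw [injective_iff_map_eq_zero]
  intro x hx
  exact eq_zero_of_leftIntegral_mul_antipode hφ h0 fun g => by simp [hx]

/-- Choose `g` so that `χ(- g)` agrees with the counit on the first legs of `Δ x`. Then `x = χ(x₁ g)
x₂ = χ(x g₁) S(g₂)` is visibly in the image of `S`. -/
theorem antipode_surjective_of_right {χ : H →ₗ[k] k} (hχ : χ ∈ rightIntegrals k H) (h0 : χ ≠ 0) :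
    Function.Surjective (antipode k (A := H)) := by
  intro x
  obtain ⟨g, hg⟩ := exists_slice_eq' (mulForm χ)
    (fun x hx => eq_zero_of_rightIntegral_mul hχ h0 hx) counit (comul (R := k) x)
  have h1 : sliceLeft (χ ∘ₗ LinearMap.mulRight k g) (comul x) = x :=
    (congrArg (TensorProduct.lid k H) hg).trans (sliceLeft_counit_comul x)
  rw [sliceLeft_mulRight, sliceLeft_comul_mul hχ x (ℛ k g)] at h1
  exact ⟨∑ i ∈ (ℛ k g).index, χ (x * (ℛ k g).left i) • (ℛ k g).right i,
    Eq.trans (by simp) h1⟩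

theorem antipode_surjective_of_left {φ : H →ₗ[k] k} (hφ : φ ∈ leftIntegrals k H) (h0 : φ ≠ 0) :
    Function.Surjective (antipode k (A := H)) := by
  intro x
  obtain ⟨g, hg⟩ := exists_slice_eq (mulForm φ).flip
    (fun x hx => eq_zero_of_mul_quasiIntegral hφ h0 hx) counit (comul (R := k) x)
  have h1 : sliceRight (φ ∘ₗ LinearMap.mulLeft k g) (comul x) = x :=
    (congrArg (TensorProduct.rid k H) hg).trans (sliceRight_counit_comul x)
  rw [sliceRight_mulLeft, sliceRight_mul_comul hφ x (ℛ k g)] at h1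
  exact ⟨∑ i ∈ (ℛ k g).index, φ ((ℛ k g).right i * x) • (ℛ k g).left i,
    Eq.trans (by simp) h1⟩

/-! ### Exchange of left and right integrals, uniqueness, and the distinguished group-like element.
-/

theorem sum_comul_antipode {a : H} {ι : Type*} (r : Repr k a ι) :
    comul (antipode k a) =
      ∑ i ∈ r.index, antipode k (r.right i) ⊗ₜ[k] antipode k (r.left i) := by
  have h := LinearMap.congr_fun (comul_antipode (k := k) (H := H)) a
  simp only [LinearMap.comp_apply] at h
  rw [h, ← r.eq]
  simp

theorem antipode_sliceRight_comp (f : H →ₗ[k] k) (a : H) :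
    antipode k (sliceRight (f ∘ₗ antipode k) (comul a)) = sliceLeft f (comul (antipode k a)) := by
  rw [sum_comul_antipode (ℛ k a), ← (ℛ k a).eq]
  simp

theorem antipode_sliceLeft_comp (f : H →ₗ[k] k) (a : H) :
    antipode k (sliceLeft (f ∘ₗ antipode k) (comul a)) = sliceRight f (comul (antipode k a)) := by
  rw [sum_comul_antipode (ℛ k a), ← (ℛ k a).eq]
  simp

theorem comp_antipode_mem_leftIntegrals {χ : H →ₗ[k] k} (hχ : χ ∈ rightIntegrals k H)
    (h0 : χ ≠ 0) : χ ∘ₗ antipode k ∈ leftIntegrals k H := by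
  rw [mem_leftIntegrals]
  intro a
  apply antipode_injective hχ h0
  rw [antipode_sliceRight_comp, mem_rightIntegrals.1 hχ, map_smul, antipode_one]
  rfl

/-- For a left integral `φ`, the functional `φ ∘ S` is a right integral: apply the injective map `S`
to the desired identity. Surjectivity of `S` keeps it non-zero. -/
theorem exists_rightIntegral_ne_zero
    (hint : rightIntegrals k H ≠ ⊥ ∨ leftIntegrals k H ≠ ⊥) :
    ∃ χ ∈ rightIntegrals k H, χ ≠ 0 := by
  rcases hint with h | h
  · exact Submodule.exists_mem_ne_zero_of_ne_bot h
  · obtain ⟨φ, hφ, h0⟩ := Submodule.exists_mem_ne_zero_of_ne_bot h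
    have hs := antipode_surjective_of_left hφ h0
    refine ⟨φ ∘ₗ antipode k, fun a => antipode_injective_of_left hφ h0 ?_, fun h => h0 ?_⟩
    · change antipode k (sliceLeft (φ ∘ₗ antipode k) (comul a)) = _
      rw [antipode_sliceLeft_comp, mem_leftIntegrals.1 hφ, map_smul, antipode_one]
      rfl
    · ext x
      obtain ⟨y, rfl⟩ := hs x
      exact LinearMap.congr_fun h y

/-- Left integrals are unique up to scalars. -/
theorem leftIntegral_proportional {χ : H →ₗ[k] k} (hχ : χ ∈ rightIntegrals k H) (h0 : χ ≠ 0)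
    {φ ψ : H →ₗ[k] k} (hφ : φ ∈ leftIntegrals k H) (hφ0 : φ ≠ 0) (hψ : ψ ∈ leftIntegrals k H) :
    ∃ c : k, ψ = c • φ := by
  let S := LinearEquiv.ofBijective (antipode k (A := H))
    ⟨antipode_injective hχ h0, antipode_surjective_of_right hχ h0⟩
  -- `δ(h) = χ(S⁻¹(h₁)) h₂` is independent of the left integral, yet `φ(g δ(h)) = χ(g) φ(h)` for
  -- each left integral `φ`. By non-degeneracy `φ(h) = 0` forces `δ(h) = 0`, whence `ψ(h) = 0`.
  let δ : H → H := fun h => sliceLeft (χ ∘ₗ S.symm.toLinearMap) (comul h)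
  have hS : ∀ x, S.symm (antipode k x) = x := S.symm_apply_apply
  have key : ∀ φ ∈ leftIntegrals k H, ∀ g h, φ (g * δ h) = χ g * φ h := by
    intro φ hφ g h
    have h1 := congrArg (χ ∘ₗ S.symm.toLinearMap) (sliceRight_mul_comul hφ h (ℛ k g))
    have h2 := congrArg φ (congrArg (· * h) (hχ g))
    have h3 : φ (g * δ h) = (χ ∘ₗ S.symm.toLinearMap) (sliceRight φ (1 ⊗ₜ g * comul h)) := by
      simp only [δ]
      generalize (comul h : H ⊗[k] H) = t
      induction t with
      | zero => simp
      | add x y hx hy => simp only [map_add, mul_add, hx, hy]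
      | tmul a b => simp [mul_comm]
    rw [h3, h1]
    refine Eq.trans ?_ (h2.trans (by simp))
    conv_rhs => rw [← (ℛ k g).eq]
    simp [hS, Finset.sum_mul, mul_comm]
  obtain ⟨g, hg⟩ : ∃ g, χ g ≠ 0 := by
    by_contra! h
    exact h0 (LinearMap.ext h)
  obtain ⟨x, hx⟩ : ∃ x, φ x ≠ 0 := by
    by_contra! h
    exact hφ0 (LinearMap.ext h)
  have hker : ∀ h, φ h = 0 → ψ h = 0 := by
    intro h hh
    have hδ : δ h = 0 := eq_zero_of_mul_quasiIntegral hφ hφ0 fun g => by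
      rw [key φ hφ, hh, mul_zero]
    have h4 := key ψ hψ g h
    rw [hδ, mul_zero, map_zero] at h4
    exact (mul_eq_zero.1 h4.symm).resolve_left hg
  refine ⟨ψ x / φ x, LinearMap.ext fun y => ?_⟩
  have h5 := hker (y - (φ y / φ x) • x) (by simp [hx])
  rw [map_sub, map_smul, sub_eq_zero] at h5
  rw [h5, LinearMap.smul_apply, smul_eq_mul, smul_eq_mul]
  ring

/-- Composition with `S` sends right integrals to left ones, where uniqueness is known; surjectivity
of `S` brings the scalar back. -/
theorem rightIntegral_proportional {χ : H →ₗ[k] k} (hχ : χ ∈ rightIntegrals k H) (h0 : χ ≠ 0)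
    {ψ : H →ₗ[k] k} (hψ : ψ ∈ rightIntegrals k H) : ∃ c : k, ψ = c • χ := by
  have hs := antipode_surjective_of_right hχ h0
  by_cases hψ0 : ψ = 0
  · exact ⟨0, by simp [hψ0]⟩
  obtain ⟨c, hc⟩ := leftIntegral_proportional hχ h0 (comp_antipode_mem_leftIntegrals hχ h0)
    (fun h => h0 (LinearMap.ext fun x => by
      obtain ⟨y, rfl⟩ := hs x
      exact LinearMap.congr_fun h y)) (comp_antipode_mem_leftIntegrals hψ hψ0)
  refine ⟨c, LinearMap.ext fun x => ?_⟩
  obtain ⟨y, rfl⟩ := hs x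
  exact LinearMap.congr_fun hc y

theorem finrank_rightIntegrals {χ : H →ₗ[k] k} (hχ : χ ∈ rightIntegrals k H) (h0 : χ ≠ 0) :
    Module.finrank k (rightIntegrals k H) = 1 := by
  refine finrank_eq_one (⟨χ, hχ⟩ : rightIntegrals k H) (fun h => h0 (congrArg Subtype.val h)) ?_
  rintro ⟨ψ, hψ⟩
  obtain ⟨c, rfl⟩ := rightIntegral_proportional hχ h0 hψ
  exact ⟨c, rfl⟩

/-- Existence of the distinguished group-like element. -/
theorem exists_distinguished {χ : H →ₗ[k] k} (hχ : χ ∈ rightIntegrals k H) (h0 : χ ≠ 0) :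
    ∃ γ : H, IsGroupLikeElem k γ ∧
      ∀ ψ ∈ rightIntegrals k H, ∀ a, sliceRight ψ (comul a) = ψ a • γ := by
  obtain ⟨x, hx⟩ : ∃ x, χ x = 1 := by
    obtain ⟨g, hg⟩ : ∃ g, χ g ≠ 0 := by
      by_contra! h
      exact h0 (LinearMap.ext h)
    exact ⟨(χ g)⁻¹ • g, by simp [hg]⟩
  -- Convolving `χ` on the left with any `ξ` gives a right integral, hence a multiple of `χ`.
  -- Testing `a₁ χ(a₂)` against all `ξ` shows that it is proportional to `x₁ χ(x₂)`, where `χ(x) =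
  -- 1`.
  have hξ : ∀ ξ : H →ₗ[k] k, convAct ξ χ ∈ rightIntegrals k H := by
    intro ξ a
    have h1 : ∀ t : H ⊗[k] H, TensorProduct.lid k H ((convAct ξ χ).rTensor H t) =
        TensorProduct.lid k H (ξ.rTensor H ((sliceLeft χ).lTensor H
          (TensorProduct.assoc k H H H ((comul : H →ₗ[k] H ⊗[k] H).rTensor H t)))) := by
      intro t
      induction t with
      | zero => simp
      | add x y hx hy => simp only [map_add, hx, hy]
      | tmul a b =>
        simp only [LinearMap.rTensor_tmul, convAct, LinearMap.comp_apply]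
        generalize (comul a : H ⊗[k] H) = s
        induction s with
        | zero => simp
        | add x y hx hy => simp only [map_add, add_tmul, hx, hy]
        | tmul c d => simp [smul_smul, mul_comm]
    rw [h1, Coalgebra.coassoc_apply, ← LinearMap.lTensor_comp_apply]
    simp only [convAct, LinearMap.comp_apply]
    generalize (comul a : H ⊗[k] H) = t
    induction t with
    | zero => simp
    | add x y hx hy => simp only [map_add, add_smul, hx, hy]
    | tmul c d =>
      have h2 : sliceLeft χ (comul d) = χ d • 1 := hχ d
      simp [h2, smul_smul, mul_comm]
  have hev : ∀ (ξ : H →ₗ[k] k) a, convAct ξ χ a = ξ (sliceRight χ (comul a)) := by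
    intro ξ a
    simp only [convAct, LinearMap.comp_apply]
    generalize (comul a : H ⊗[k] H) = t
    induction t with
    | zero => simp
    | add x y hx hy => simp only [map_add, hx, hy]
    | tmul c d => simp [mul_comm]
  let γ : H := sliceRight χ (comul x)
  have hγ : ∀ a, sliceRight χ (comul a) = χ a • γ := by
    intro a
    rw [← sub_eq_zero, ← Module.forall_dual_apply_eq_zero_iff k]
    intro ξ
    obtain ⟨c, hc⟩ := rightIntegral_proportional hχ h0 (hξ ξ)
    rw [map_sub, map_smul, ← hev, ← hev, hc]
    simp [hx, mul_comm]
  refine ⟨γ, ⟨?_, ?_⟩, ?_⟩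
  · have h1 : (counit : H →ₗ[k] k) (sliceRight χ (comul x)) =
        χ (sliceLeft (counit : H →ₗ[k] k) (comul x)) := by
      generalize (comul x : H ⊗[k] H) = t
      induction t with
      | zero => simp
      | add x y hx hy => simp only [map_add, hx, hy]
      | tmul c d => simp [mul_comm]
    rw [sliceLeft_counit_comul, hx] at h1
    exact h1
  -- By coassociativity `Δ(γ) = x₁ ⊗ x₂ χ(x₃) = x₁ χ(x₂) ⊗ γ = γ ⊗ γ`.
  · have h1 : ∀ t : H ⊗[k] H, comul (R := k) (sliceRight χ t) =
        TensorProduct.rid k _ (χ.lTensor (H ⊗[k] H) ((comul : H →ₗ[k] H ⊗[k] H).rTensor H t)) := by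
      intro t
      induction t with
      | zero => simp
      | add x y hx hy => simp only [map_add, hx, hy]
      | tmul c d => simp
    have h2 : ∀ t : (H ⊗[k] H) ⊗[k] H, TensorProduct.rid k _ (χ.lTensor (H ⊗[k] H) t) =
        (sliceRight χ).lTensor H (TensorProduct.assoc k H H H t) := by
      intro t
      induction t with
      | zero => simp
      | add x y hx hy => simp only [map_add, hx, hy]
      | tmul s d =>
        induction s with
        | zero => simp
        | add x y hx hy => simp only [map_add, add_tmul, hx, hy]
        | tmul a b => simp
    have h3 : ∀ t : H ⊗[k] H, (sliceRight χ ∘ₗ comul).lTensor H t = sliceRight χ t ⊗ₜ γ := by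
      intro t
      induction t with
      | zero => simp
      | add x y hx hy => simp only [map_add, add_tmul, hx, hy]
      | tmul a b => simp [hγ, smul_tmul]
    change comul (R := k) (sliceRight χ (comul x)) = _
    rw [h1, h2, Coalgebra.coassoc_apply, ← LinearMap.lTensor_comp_apply, h3]
  · intro ψ hψ a
    obtain ⟨c, rfl⟩ := rightIntegral_proportional hχ h0 hψ
    have h1 : ∀ t : H ⊗[k] H, sliceRight (c • χ) t = c • sliceRight χ t := by
      intro t
      rw [sliceRight, LinearMap.lTensor_smul]
      simp [sliceRight]
    rw [h1, hγ, smul_smul]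
    rfl

end Nondegenerate

/-! ### Existence of the left adjoint as `H ⊗_{H^*} M`. -/

section LeftAdjoint

variable {k H : Type u} [Field k] [Ring H] [HopfAlgebra k H]

theorem mem_homSpace {M N : RightComod k H} {f : M →ₗ[k] N} :
    f ∈ homSpace M N ↔ N.coact ∘ₗ f = f.rTensor H ∘ₗ M.coact := Iff.rfl

theorem comp_mem_homSpace {M N P : RightComod k H} {g : N →ₗ[k] P} {f : M →ₗ[k] N}
    (hg : g ∈ homSpace N P) (hf : f ∈ homSpace M N) : g ∘ₗ f ∈ homSpace M P :=
  (CategoryStruct.comp (X := M) (⟨f, hf⟩ : homSpace M N) (⟨g, hg⟩ : homSpace N P)).2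

theorem lsum_comp_lsingle {I V : Type u} [AddCommGroup V] [Module k V] (g : I → H →ₗ[k] V) (i : I) :
    (Finsupp.lsum k g) ∘ₗ (Finsupp.lsingle i : H →ₗ[k] I →₀ H) = g i := by
  ext h
  simp

theorem id_mem_homSpace (M : RightComod k H) : LinearMap.id ∈ homSpace M M :=
  (𝟙 M : homSpace M M).2

/-- The quotient of a comodule by a subcomodule. -/
abbrev quotient (X : RightComod k H) (K : Submodule k X)
    (hK : K ≤ LinearMap.ker (K.mkQ.rTensor H ∘ₗ X.coact)) : RightComod k H where
  carrier := X ⧸ K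
  coact := K.liftQ (K.mkQ.rTensor H ∘ₗ X.coact) hK
  coassoc := by
    apply Submodule.linearMap_qext
    have h1 : (TensorProduct.assoc k (X ⧸ K) H H).toLinearMap ∘ₗ (K.mkQ.rTensor H).rTensor H =
        K.mkQ.rTensor (H ⊗[k] H) ∘ₗ (TensorProduct.assoc k X H H).toLinearMap := by
      ext; simp
    have h2 : (comul : H →ₗ[k] H ⊗[k] H).lTensor (X ⧸ K) ∘ₗ K.mkQ.rTensor H =
        K.mkQ.rTensor (H ⊗[k] H) ∘ₗ (comul : H →ₗ[k] H ⊗[k] H).lTensor X := by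
      rw [LinearMap.lTensor_comp_rTensor, LinearMap.rTensor_comp_lTensor]
    rw [LinearMap.comp_assoc, LinearMap.comp_assoc, LinearMap.comp_assoc, Submodule.liftQ_mkQ,
      ← LinearMap.comp_assoc _ _ (LinearMap.rTensor H _), ← LinearMap.rTensor_comp,
      Submodule.liftQ_mkQ, LinearMap.rTensor_comp, LinearMap.comp_assoc,
      ← LinearMap.comp_assoc _ _ (LinearEquiv.toLinearMap _), h1, LinearMap.comp_assoc, X.coassoc,
      ← LinearMap.comp_assoc _ _ (LinearMap.lTensor _ _), h2, LinearMap.comp_assoc]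
  counit_coact := by
    apply Submodule.linearMap_qext
    have h1 : (TensorProduct.rid k (X ⧸ K)).toLinearMap ∘ₗ (counit : H →ₗ[k] k).lTensor (X ⧸ K) ∘ₗ
        K.mkQ.rTensor H = K.mkQ ∘ₗ (TensorProduct.rid k X).toLinearMap ∘ₗ
          (counit : H →ₗ[k] k).lTensor X := by
      ext; simp
    rw [LinearMap.comp_assoc, LinearMap.comp_assoc, Submodule.liftQ_mkQ,
      ← LinearMap.comp_assoc X.coact, ← LinearMap.comp_assoc X.coact, h1, LinearMap.comp_assoc,
      LinearMap.comp_assoc, X.counit_coact]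
    rfl

theorem mkQ_mem_homSpace (X : RightComod k H) (K : Submodule k X)
    (hK : K ≤ LinearMap.ker (K.mkQ.rTensor H ∘ₗ X.coact)) :
    K.mkQ ∈ homSpace X (quotient X K hK) :=
  K.liftQ_mkQ _ hK

theorem liftQ_mem_homSpace {X Y : RightComod k H} (K : Submodule k X)
    (hK : K ≤ LinearMap.ker (K.mkQ.rTensor H ∘ₗ X.coact)) {f : X →ₗ[k] Y}
    (hf : f ∈ homSpace X Y) (hKf : K ≤ LinearMap.ker f) :
    K.liftQ f hKf ∈ homSpace (quotient X K hK) Y := by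
  apply Submodule.linearMap_qext
  change Y.coact ∘ₗ K.liftQ f hKf ∘ₗ K.mkQ = (K.liftQ f hKf).rTensor H ∘ₗ
    K.liftQ (K.mkQ.rTensor H ∘ₗ X.coact) hK ∘ₗ K.mkQ
  rw [Submodule.liftQ_mkQ, Submodule.liftQ_mkQ, ← LinearMap.comp_assoc, ← LinearMap.rTensor_comp,
    Submodule.liftQ_mkQ, mem_homSpace.1 hf]

variable (k H) in
/-- The direct sum of copies of the regular comodule indexed by `I`. -/
noncomputable abbrev free (I : Type u) : RightComod k H where
  carrier := I →₀ H
  coact := Finsupp.lsum k fun i => (Finsupp.lsingle i).rTensor H ∘ₗ comul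
  coassoc := by
    apply Finsupp.lhom_ext'
    intro i
    apply LinearMap.ext
    intro h
    simp only [LinearMap.comp_apply, LinearEquiv.coe_coe, Finsupp.lsingle_apply, Finsupp.lsum_single]
    have h1 := Coalgebra.coassoc_apply (R := k) h
    have h2 : ∀ t : H ⊗[k] H, TensorProduct.assoc k (I →₀ H) H H
        ((Finsupp.lsum k fun i : I => (Finsupp.lsingle (R := k) (M := H) i).rTensor H ∘ₗ
          comul).rTensor H
            ((Finsupp.lsingle (R := k) (M := H) i).rTensor H t)) =
        (Finsupp.lsingle (R := k) (M := H) i).rTensor (H ⊗[k] H)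
          (TensorProduct.assoc k H H H ((comul : H →ₗ[k] H ⊗[k] H).rTensor H t)) := by
      intro t
      induction t with
      | zero => simp
      | add x y hx hy => simp only [map_add, hx, hy]
      | tmul a b =>
        simp only [LinearMap.rTensor_tmul, Finsupp.lsingle_apply, Finsupp.lsum_single,
          LinearMap.comp_apply]
        generalize (comul a : H ⊗[k] H) = s
        induction s with
        | zero => simp
        | add x y hx hy => simp only [map_add, add_tmul, hx, hy]
        | tmul c d => simp
    rw [h2, h1, ← LinearMap.comp_apply, ← LinearMap.comp_apply (LinearMap.lTensor _ _),
      LinearMap.lTensor_comp_rTensor, LinearMap.rTensor_comp_lTensor]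
  counit_coact := by
    apply Finsupp.lhom_ext'
    intro i
    apply LinearMap.ext
    intro h
    simp only [LinearMap.comp_apply, LinearEquiv.coe_coe, Finsupp.lsingle_apply, Finsupp.lsum_single]
    have h1 := sliceRight_counit_comul (k := k) h
    conv_rhs => rw [← h1]
    generalize (comul h : H ⊗[k] H) = t
    induction t with
    | zero => simp
    | add x y hx hy =>
      simp only [map_add, hx, hy, LinearMap.id_apply, Finsupp.single_add]
    | tmul c d => simp

theorem lsingle_mem_homSpace {I : Type u} (i : I) :
    (Finsupp.lsingle i : H →ₗ[k] I →₀ H) ∈ homSpace (regular k H) (free k H I) :=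
  lsum_comp_lsingle _ i

theorem lsum_mem_homSpace {I : Type u} {Y : RightComod k H}
    (f : I → homSpace (regular k H) Y) :
    (Finsupp.lsum k fun i => (f i).1) ∈ homSpace (free k H I) Y := by
  apply Finsupp.lhom_ext'
  intro i
  have h1 : (Finsupp.lsum k fun i => (f i).1) ∘ₗ (Finsupp.lsingle i : H →ₗ[k] I →₀ H) = (f i).1 :=
    lsum_comp_lsingle _ i
  have h2 : (free k H I).coact ∘ₗ (Finsupp.lsingle i : H →ₗ[k] I →₀ H) =
      (Finsupp.lsingle i : H →ₗ[k] I →₀ H).rTensor H ∘ₗ comul := lsingle_mem_homSpace i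
  rw [LinearMap.comp_assoc, LinearMap.comp_assoc, h1, h2, ← LinearMap.comp_assoc,
    ← LinearMap.rTensor_comp, h1]
  exact (f i).2

/-- The action of `ξ` is precomposition with one endomorphism of `H`, so the balancing relations can
be stated as maps out of `H`. -/
theorem convAct_eq_comp {X : Type u} [AddCommGroup X] [Module k X] (ξ : H →ₗ[k] k)
    (f : H →ₗ[k] X) : convAct ξ f = f ∘ₗ convAct ξ LinearMap.id := by
  apply LinearMap.ext
  intro h
  simp only [convAct, LinearMap.comp_apply]
  generalize (comul h : H ⊗[k] H) = t
  induction t with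
  | zero => simp
  | add x y hx hy => simp only [map_add, hx, hy]
  | tmul c d => simp

variable (M : ModuleCat.{u} (DualAlg k H))

/-- The relations defining `H ⊗_{H^*} M` as a quotient of a direct sum of copies of `H`. -/
def relations : Set (H →ₗ[k] M →₀ H) :=
  {r | (∃ m m' : M, r = Finsupp.lsingle (m + m') - Finsupp.lsingle m - Finsupp.lsingle m') ∨
    ∃ (ξ : DualAlg k H) (m : M), r = Finsupp.lsingle (ξ • m) -
      Finsupp.lsingle m ∘ₗ convAct ξ.ofConv LinearMap.id}

/-- The span of the relations. -/
noncomputable def relSubmodule : Submodule k (M →₀ H) := ⨆ r ∈ relations M, LinearMap.range r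

theorem relations_subset {r : H →ₗ[k] M →₀ H} (hr : r ∈ relations M) :
    r ∈ homSpace (regular k H) (free k H M) := by
  rcases hr with ⟨m, m', rfl⟩ | ⟨ξ, m, rfl⟩
  · exact Submodule.sub_mem _ (Submodule.sub_mem _ (lsingle_mem_homSpace _)
      (lsingle_mem_homSpace _)) (lsingle_mem_homSpace _)
  · exact Submodule.sub_mem _ (lsingle_mem_homSpace _)
      (comp_mem_homSpace (M := regular k H) (N := regular k H) (lsingle_mem_homSpace _)
        (convAct_mem (regular k H) _ _ (id_mem_homSpace (regular k H))))

theorem relSubmodule_le_ker {V : Type u} [AddCommGroup V] [Module k V] {f : (M →₀ H) →ₗ[k] V} :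
    relSubmodule M ≤ LinearMap.ker f ↔ ∀ r ∈ relations M, f ∘ₗ r = 0 := by
  simp only [relSubmodule, iSup_le_iff, LinearMap.range_le_ker_iff]

/-- Every relation is a comodule map from `H`, so the sum of their images is a subcomodule and the
coaction descends. -/
theorem relSubmodule_subcomodule : relSubmodule M ≤
    LinearMap.ker ((relSubmodule M).mkQ.rTensor H ∘ₗ (free k H M).coact) := by
  refine (relSubmodule_le_ker M).2 fun r hr => ?_
  have h1 : (relSubmodule M).mkQ ∘ₗ r = 0 :=
    (relSubmodule_le_ker M (f := (relSubmodule M).mkQ)).1 (by rw [Submodule.ker_mkQ]) r hr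
  have h2 := mem_homSpace.1 (relations_subset M hr)
  rw [LinearMap.comp_assoc, h2, ← LinearMap.comp_assoc, ← LinearMap.rTensor_comp, h1,
    LinearMap.rTensor_zero, LinearMap.zero_comp]

/-- The comodule `H ⊗_{H^*} M`. -/
noncomputable def balanced : RightComod k H :=
  quotient (free k H M) (relSubmodule M) (relSubmodule_subcomodule M)

/-- `h ↦ h ⊗ m` as a comodule map `H → H ⊗_{H^*} M`. -/
noncomputable def balancedMk (m : M) : homSpace (regular k H) (balanced M) :=
  ⟨(relSubmodule M).mkQ ∘ₗ Finsupp.lsingle m,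
    comp_mem_homSpace (mkQ_mem_homSpace (free k H M) _ _) (lsingle_mem_homSpace m)⟩

theorem balancedMk_rel {r : H →ₗ[k] M →₀ H} (hr : r ∈ relations M) :
    (relSubmodule M).mkQ ∘ₗ r = 0 :=
  (relSubmodule_le_ker M (f := (relSubmodule M).mkQ)).1 (by rw [Submodule.ker_mkQ]) r hr

/-- The universal map `M → Hom^H(H, H ⊗_{H^*} M)`. -/
noncomputable def balancedUnit : M ⟶ (homFunctor k H).obj (balanced M) :=
  ModuleCat.ofHom (Y := homSpace (regular k H) (balanced M))
    { toFun := balancedMk M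
      map_add' := fun m m' => by
        apply Subtype.ext
        have h := balancedMk_rel M (Or.inl ⟨m, m', rfl⟩)
        rw [LinearMap.comp_sub, LinearMap.comp_sub, sub_sub, sub_eq_zero] at h
        exact h
      map_smul' := fun ξ m => by
        apply Subtype.ext
        have h := balancedMk_rel M (Or.inr ⟨ξ, m, rfl⟩)
        rw [LinearMap.comp_sub, sub_eq_zero, ← LinearMap.comp_assoc] at h
        exact h.trans (convAct_eq_comp ξ.ofConv (balancedMk M m).1).symm }

theorem balancedUnit_comp_bijective (Y : RightComod k H) : Function.Bijective
    fun f : balanced M ⟶ Y => balancedUnit M ≫ (homFunctor k H).map f := by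
  constructor
  · intro f g hfg
    apply Subtype.ext
    apply Submodule.linearMap_qext
    apply Finsupp.lhom_ext'
    intro m
    have h := congrArg (fun F : M ⟶ (homFunctor k H).obj Y =>
      (F.hom m : homSpace (regular k H) Y).1) hfg
    exact h
  · intro F
    let φ : M → homSpace (regular k H) Y := fun m => F.hom m
    have hφ : ∀ m, (Finsupp.lsum k fun i => (φ i).1) ∘ₗ (Finsupp.lsingle m : H →ₗ[k] M →₀ H) =
        (φ m).1 := fun m => lsum_comp_lsingle _ m
    have hker : relSubmodule M ≤ LinearMap.ker (Finsupp.lsum k fun i => (φ i).1) := by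
      refine (relSubmodule_le_ker M).2 fun r hr => ?_
      rcases hr with ⟨m, m', rfl⟩ | ⟨ξ, m, rfl⟩
      · rw [LinearMap.comp_sub, LinearMap.comp_sub, hφ, hφ, hφ, sub_sub, sub_eq_zero]
        exact congrArg Subtype.val (F.hom.map_add m m')
      · rw [LinearMap.comp_sub, ← LinearMap.comp_assoc, hφ, hφ, sub_eq_zero, ← convAct_eq_comp]
        exact congrArg Subtype.val (F.hom.map_smul ξ m)
    refine ⟨⟨(relSubmodule M).liftQ _ hker,
      liftQ_mem_homSpace _ (relSubmodule_subcomodule M) (lsum_mem_homSpace φ) hker⟩, ?_⟩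
    apply ModuleCat.hom_ext
    apply LinearMap.ext
    intro m
    exact Subtype.ext (hφ m)

variable (k H) in
-- It suffices to corepresent `Hom(M, T(-))` for each `M` separately; `balancedUnit` is the
-- universal element.
theorem homFunctor_isRightAdjoint : (homFunctor k H).IsRightAdjoint := by
  apply Functor.isRightAdjoint_of_leftAdjointObjIsDefined_eq_top
  ext M
  simp only [Functor.leftAdjointObjIsDefined_iff, Pi.top_apply, Prop.top_eq_true, iff_true]
  exact ⟨balanced M, ⟨{
    homEquiv := Equiv.ofBijective _ (balancedUnit_comp_bijective M _)
    homEquiv_comp := fun g f => by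
      simp }⟩⟩

end LeftAdjoint

/-! ### The coalgebra automorphism `b ↦ S²(b)γ` and the twisted pairing. -/

section Twist

variable {k H : Type u} [Field k] [Ring H] [HopfAlgebra k H]

/-- The coalgebra endomorphism `b ↦ S²(b) γ`. -/
noncomputable def twistHom (γ : H) (hγ : IsGroupLikeElem k γ) : H →ₗc[k] H where
  toLinearMap := LinearMap.mulRight k γ ∘ₗ antipode k ∘ₗ antipode k
  counit_comp := by
    ext b
    simp [hγ.counit_eq_one]
  map_comp_comul := by
    ext b
    let r := ℛ k b
    let r' : Repr k (antipode k b) _ :=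
      ⟨r.index, fun i => antipode k (r.right i), fun i => antipode k (r.left i),
        (sum_comul_antipode r).symm⟩
    simp only [LinearMap.comp_apply, LinearMap.mulRight_apply, Bialgebra.comul_mul,
      hγ.comul_eq_tmul_self, sum_comul_antipode r']
    rw [← r.eq]
    simp [r', Finset.sum_mul]

theorem twistHom_apply (γ : H) (hγ : IsGroupLikeElem k γ) (b : H) :
    twistHom γ hγ b = antipode k (antipode k b) * γ := rfl

/-- A twisted pairing on `H`: the compatibilities with the comultiplication
satisfied by `(a, h) ↦ χ(S(κ a) h)`. -/
structure IsTwistedPairing (κ : H →ₗc[k] H) (B : H →ₗ[k] H →ₗ[k] k) : Prop where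
  left : ∀ a h, sliceLeft (B a) (comul h) = κ (sliceRight (B.flip h) (comul a))
  right : ∀ a h, sliceRight (B a) (comul h) = sliceLeft (B.flip h) (comul a)
  separatingLeft : ∀ a, (∀ h, B a h = 0) → a = 0
  separatingRight : ∀ h, (∀ a, B a h = 0) → h = 0

theorem exists_twistedPairing {χ : H →ₗ[k] k} (hχ : χ ∈ rightIntegrals k H) (h0 : χ ≠ 0) {γ : H}
    (hγ : IsGroupLikeElem k γ) (hχγ : ∀ a, sliceRight χ (comul a) = χ a • γ) :
    ∃ (κ : H →ₗc[k] H) (B : H →ₗ[k] H →ₗ[k] k), IsTwistedPairing κ B ∧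
      ∀ a, twistHom γ hγ (κ a) = a := by
  have hinj := antipode_injective hχ h0
  have hsurj := antipode_surjective_of_right hχ h0
  have hγ1 : γ * antipode k γ = 1 := hγ.mul_antipode_cancel
  have hγ2 : antipode k γ * γ = 1 := hγ.antipode_mul_cancel
  have hbij : Function.Bijective (twistHom γ hγ) := by
    constructor
    · intro a b hab
      have h := congrArg (· * antipode k γ) hab
      simp only [twistHom_apply, mul_assoc, hγ1, mul_one] at h
      exact hinj (hinj h)
    · intro a
      obtain ⟨b, hb⟩ := hsurj (a * antipode k γ)
      obtain ⟨c, rfl⟩ := hsurj b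
      exact ⟨c, by rw [twistHom_apply, hb, mul_assoc, hγ2, mul_one]⟩
  let E := CoalgEquiv.ofBijective hbij
  let κ : H →ₗc[k] H := E.symm
  have hκ : ∀ a, twistHom γ hγ (κ a) = a := fun a => E.apply_symm_apply a
  have hκs : Function.Surjective κ := E.symm.toEquiv.surjective
  have hκi : Function.Injective κ := E.symm.toEquiv.injective
  let B : H →ₗ[k] H →ₗ[k] k := mulForm χ ∘ₗ antipode k ∘ₗ (κ : H →ₗ[k] H)
  have hB : ∀ a h, B a h = χ (antipode k (κ a) * h) := fun _ _ => rfl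
  have hr : ∀ a, ∑ i ∈ (ℛ k a).index, κ ((ℛ k a).left i) ⊗ₜ[k] κ ((ℛ k a).right i) =
      comul (κ a) := by
    intro a
    rw [← CoalgHomClass.map_comp_comul_apply, ← (ℛ k a).eq]
    simp
  refine ⟨κ, B, ⟨fun a h => ?_, fun a h => ?_, fun a ha => ?_, fun h hh => ?_⟩, hκ⟩
  · refine (sliceLeft_mulLeft χ (antipode k (κ a)) (comul h)).trans ?_
    rw [sliceLeft_antipode_mul_comul hχ h ⟨_, _, _, hr a⟩, ← (ℛ k a).eq]
    simp [hB]
  -- Here the choice of `κ` is forced: slicing `χ` on its other side produces `S²(κ(a₂))γ`, which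
  -- must equal `a₂`.
  · refine (sliceRight_mulLeft χ (antipode k (κ a)) (comul h)).trans ?_
    rw [sliceRight_mul_comul hχγ h ⟨_, _, _, (sum_comul_antipode ⟨_, _, _, hr a⟩).symm⟩,
      ← (ℛ k a).eq]
    simp [hB, ← twistHom_apply γ hγ, hκ]
  · apply hκi
    rw [map_zero]
    exact eq_zero_of_rightIntegral_antipode_mul hχ h0 ha
  · refine eq_zero_of_mul_quasiIntegral hχγ h0 fun g => ?_
    obtain ⟨b, rfl⟩ := hsurj g
    obtain ⟨a, rfl⟩ := hκs b
    exact hh a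

end Twist

/-! ### The twisted comodule `N^κ` and the map `N → Hom^H(H, N^κ)`. -/

section Pushforward

variable {k H : Type u} [Field k] [Ring H] [HopfAlgebra k H]

/-- The comodule `N` with coaction `n ↦ n₀ ⊗ κ(n₁)`. -/
abbrev pushforward (N : RightComod k H) (κ : H →ₗc[k] H) : RightComod k H where
  carrier := N
  coact := (κ : H →ₗ[k] H).lTensor N ∘ₗ N.coact
  coassoc := by
    have h1 : (TensorProduct.assoc k N H H).toLinearMap ∘ₗ
        ((κ : H →ₗ[k] H).lTensor N).rTensor H ∘ₗ (κ : H →ₗ[k] H).lTensor (N ⊗[k] H) =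
        (TensorProduct.map (κ : H →ₗ[k] H) (κ : H →ₗ[k] H)).lTensor N ∘ₗ
          (TensorProduct.assoc k N H H).toLinearMap := by
      ext; simp
    have h2 : N.coact.rTensor H ∘ₗ (κ : H →ₗ[k] H).lTensor N =
        (κ : H →ₗ[k] H).lTensor (N ⊗[k] H) ∘ₗ N.coact.rTensor H := by
      rw [LinearMap.lTensor_comp_rTensor, LinearMap.rTensor_comp_lTensor]
    rw [LinearMap.rTensor_comp, LinearMap.comp_assoc, ← LinearMap.comp_assoc N.coact, h2,
      LinearMap.comp_assoc]
    simp only [← LinearMap.comp_assoc] at h1 ⊢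
    rw [h1]
    simp only [LinearMap.comp_assoc]
    rw [N.coassoc, ← LinearMap.comp_assoc, ← LinearMap.lTensor_comp, ← LinearMap.comp_assoc,
      ← LinearMap.lTensor_comp, CoalgHomClass.map_comp_comul]
  counit_coact := by
    rw [← LinearMap.comp_assoc N.coact, ← LinearMap.lTensor_comp, CoalgHomClass.counit_comp]
    exact N.counit_coact

/-- The slice `v ⊗ w ↦ f(w) v`. -/
noncomputable def slice {V W : Type u} [AddCommGroup V] [Module k V] [AddCommGroup W] [Module k W]
    (f : W →ₗ[k] k) : V ⊗[k] W →ₗ[k] V :=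
  (TensorProduct.rid k V).toLinearMap ∘ₗ f.lTensor V

@[simp] theorem slice_tmul {V W : Type u} [AddCommGroup V] [Module k V] [AddCommGroup W]
    [Module k W] (f : W →ₗ[k] k) (v : V) (w : W) : slice f (v ⊗ₜ[k] w) = f w • v := by
  simp [slice]

theorem slice_counit_coact (N : RightComod k H) (n : N) : slice counit (N.coact n) = n :=
  LinearMap.congr_fun N.counit_coact n

theorem convAct_apply {X : Type u} [AddCommGroup X] [Module k X] (ξ : H →ₗ[k] k)
    (f : H →ₗ[k] X) (h : H) : convAct ξ f h = f (sliceLeft ξ (comul h)) := by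
  rw [convAct_eq_comp, LinearMap.comp_apply]
  rfl

theorem convMul_apply_eq (ξ η : DualAlg k H) (a : H) :
    (ξ * η).ofConv a = η.ofConv (sliceLeft ξ.ofConv (comul a)) := by
  change LinearMap.mul' k k (TensorProduct.map ξ.ofConv η.ofConv (comul a)) = _
  generalize (comul a : H ⊗[k] H) = t
  induction t with
  | zero => simp
  | add x y hx hy => simp only [map_add, hx, hy]
  | tmul c d => simp

variable {κ : H →ₗc[k] H} {B : H →ₗ[k] H →ₗ[k] k}

/-- The map `h ↦ n₀ B(n₁, h)`. -/
noncomputable def pairingMap (B : H →ₗ[k] H →ₗ[k] k) (N : RightComod k H) (n : N) : H →ₗ[k] N :=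
  (TensorProduct.rid k N).toLinearMap ∘ₗ (LinearMap.lTensorHom N).flip (N.coact n) ∘ₗ B.flip

theorem pairingMap_apply (B : H →ₗ[k] H →ₗ[k] k) (N : RightComod k H) (n : N) (h : H) :
    pairingMap B N n h = slice (B.flip h) (N.coact n) := rfl

/-- Coassociativity of `N` moves both sides to slices of `n₀ ⊗ n₁`, where the condition becomes the
first pairing identity `hB.left`. -/
theorem pairingMap_mem (hB : IsTwistedPairing κ B) (N : RightComod k H) (n : N) :
    pairingMap B N n ∈ homSpace (regular k H) (pushforward N κ) := by
  apply LinearMap.ext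
  intro h
  change (κ : H →ₗ[k] H).lTensor N (N.coact (pairingMap B N n h)) =
    (pairingMap B N n).rTensor H (comul h)
  have h1 : ∀ t : N ⊗[k] H, (κ : H →ₗ[k] H).lTensor N (N.coact (slice (B.flip h) t)) =
      ((κ : H →ₗ[k] H) ∘ₗ sliceRight (B.flip h)).lTensor N
        (TensorProduct.assoc k N H H (N.coact.rTensor H t)) := by
    intro t
    induction t with
    | zero => simp
    | add x y hx hy => simp only [map_add, hx, hy]
    | tmul m a =>
      simp only [slice_tmul, map_smul, LinearMap.rTensor_tmul]
      generalize N.coact m = s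
      induction s with
      | zero => simp
      | add x y hx hy => simp only [map_add, add_tmul, smul_add, hx, hy]
      | tmul c d => simp
  have h3 : (pairingMap B N n).rTensor H (comul h) =
      ((LinearMap.applyₗ (comul h : H ⊗[k] H) ∘ₗ
        LinearMap.llcomp k _ _ _ (TensorProduct.lid k H).toLinearMap ∘ₗ
          LinearMap.rTensorHom H ∘ₗ B)).lTensor N (N.coact n) := by
    generalize (comul h : H ⊗[k] H) = t
    induction t with
    | zero => simp
    | add x y hx hy =>
      rw [map_add, hx, hy, map_add, LinearMap.add_comp, LinearMap.lTensor_add, LinearMap.add_apply]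
    | tmul c d =>
      rw [LinearMap.rTensor_tmul, pairingMap_apply]
      generalize N.coact n = s
      induction s with
      | zero => simp
      | add x y hx hy => simp only [map_add, add_tmul, hx, hy]
      | tmul m a => simp [smul_tmul]
  rw [pairingMap_apply, h1, h3]
  have h4 := LinearMap.congr_fun N.coassoc n
  simp only [LinearMap.comp_apply, LinearEquiv.coe_coe] at h4
  rw [h4, ← LinearMap.lTensor_comp_apply]
  congr 2
  ext a
  exact (hB.left a h).symm

/-- The universal `H^*`-linear map `N → Hom^H(H, N^κ)`. -/
noncomputable def pairingUnit (hB : IsTwistedPairing κ B) (N : RightComod k H) :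
    ratModule N ⟶ (homFunctor k H).obj (pushforward N κ) :=
  letI := ratModuleStruct N
  ModuleCat.ofHom (X := N) (Y := homSpace (regular k H) (pushforward N κ))
    { toFun := fun n => ⟨pairingMap B N n, pairingMap_mem hB N n⟩
      map_add' := fun m n => by
        apply Subtype.ext
        apply LinearMap.ext
        intro h
        change slice _ (N.coact (m + n)) = slice _ (N.coact m) + slice _ (N.coact n)
        rw [map_add, map_add]
      map_smul' := fun ξ n => by
        apply Subtype.ext
        apply LinearMap.ext
        intro h
        -- Evaluation at `h` is the action of `B(-, h) ∈ H^*`, so linearity reduces to an identity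
        -- of functionals, supplied by `hB.right`.
        change (WithConv.toConv (B.flip h) : DualAlg k H) • (ξ • n : N) =
          convAct ξ.ofConv (pairingMap B N n) h
        rw [smul_smul, convAct_apply]
        change slice _ (N.coact n) = slice _ (N.coact n)
        congr 1
        congr 1
        ext a
        rw [convMul_apply_eq]
        change ξ.ofConv (sliceLeft (B.flip h) (comul a)) = B a (sliceLeft ξ.ofConv (comul h))
        rw [← hB.right]
        generalize (comul h : H ⊗[k] H) = t
        induction t with
        | zero => simp
        | add x y hx hy => simp only [map_add, hx, hy]
        | tmul c d => simp [mul_comm] }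

/-- Take `h` with `B(-, h)` equal to the counit on the legs of the coaction of `n`. Thus `N^κ` is
covered by the images of the maps `pairingMap B N n`. -/
theorem exists_pairingMap_eq (hB : IsTwistedPairing κ B) (N : RightComod k H) (n : N) :
    ∃ h, pairingMap B N n h = n := by
  obtain ⟨h, hh⟩ := exists_slice_eq B hB.separatingLeft counit (N.coact n)
  exact ⟨h, (congrArg (TensorProduct.rid k N) hh).trans (slice_counit_coact N n)⟩

/-! ### Universality of `N → Hom^H(H, N^κ)` and identification of `U(N)`. -/

variable {X : RightComod k H} {N : RightComod k H}

/-- The linear maps `H → X` underlying an `H^*`-linear map `N → Hom^H(H, X)`. -/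
noncomputable def toMap (F : ratModule N ⟶ (homFunctor k H).obj X) (n : N) : H →ₗ[k] X :=
  (F.hom n : homSpace (regular k H) X).1

theorem toMap_mem (F : ratModule N ⟶ (homFunctor k H).obj X) (n : N) :
    toMap F n ∈ homSpace (regular k H) X :=
  (F.hom n : homSpace (regular k H) X).2

theorem toMap_add (F : ratModule N ⟶ (homFunctor k H).obj X) (m n : N) :
    toMap F (m + n) = toMap F m + toMap F n :=
  congrArg Subtype.val (F.hom.map_add m n)

theorem toMap_slice (F : ratModule N ⟶ (homFunctor k H).obj X) (ξ : H →ₗ[k] k) (n : N) :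
    toMap F (slice ξ (N.coact n)) = convAct ξ (toMap F n) :=
  congrArg Subtype.val (F.hom.map_smul (WithConv.toConv ξ) n)

/-- Only `H^*`-linearity is given; a scalar `c` acts as the functional `c ε`. -/
theorem toMap_smul (F : ratModule N ⟶ (homFunctor k H).obj X) (c : k) (n : N) :
    toMap F (c • n) = c • toMap F n := by
  have h1 : c • n = slice (c • counit) (N.coact n) := by
    conv_lhs => rw [← slice_counit_coact N n]
    simp [slice, LinearMap.lTensor_smul]
  rw [h1, toMap_slice]
  ext h
  rw [convAct_apply]
  have h2 : sliceLeft (c • (counit : H →ₗ[k] k)) (comul h) = c • h := by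
    conv_rhs => rw [← sliceLeft_counit_comul (k := k) h]
    simp [sliceLeft, LinearMap.rTensor_smul]
  rw [h2, map_smul, LinearMap.smul_apply]

/-- The evaluation `n ⊗ h ↦ F(n)(h)`. -/
noncomputable def evalMap (F : ratModule N ⟶ (homFunctor k H).obj X) : N ⊗[k] H →ₗ[k] X :=
  TensorProduct.lift
    { toFun := toMap F
      map_add' := toMap_add F
      map_smul' := toMap_smul F }

@[simp] theorem evalMap_tmul (F : ratModule N ⟶ (homFunctor k H).obj X) (n : N) (h : H) :
    evalMap F (n ⊗ₜ h) = toMap F n h := rfl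

theorem toMap_pairingUnit (hB : IsTwistedPairing κ B) (n : N) :
    toMap (pairingUnit hB N) n = pairingMap B N n := rfl

theorem evalMap_pairingUnit_surjective (hB : IsTwistedPairing κ B) (N : RightComod k H) :
    Function.Surjective (evalMap (pairingUnit hB N)) := fun n => by
  obtain ⟨h, hh⟩ := exists_pairingMap_eq hB N n
  exact ⟨n ⊗ₜ h, hh⟩

/-- On `n ⊗ h`, linearity gives `F(n₀ B(n₁, h))(e) = F(n)(B(e₁, h) e₂) = F(n)(h₁ B(e, h₂))`, and
colinearity of `F(n)` turns this into `x₀ B(e, x₁)` with `x = F(n)(h)`. -/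
theorem toMap_evalMap (hB : IsTwistedPairing κ B) (F : ratModule N ⟶ (homFunctor k H).obj X)
    (t : N ⊗[k] H) (e : H) :
    toMap F (evalMap (pairingUnit hB N) t) e = slice (B e) (X.coact (evalMap F t)) := by
  induction t with
  | zero =>
    rw [map_zero, map_zero, map_zero, map_zero]
    exact LinearMap.congr_fun (congrArg Subtype.val F.hom.map_zero) e
  | add x y hx hy =>
    rw [map_add, map_add, map_add, map_add, ← hx, ← hy]
    exact LinearMap.congr_fun (toMap_add F _ _) e
  | tmul n h =>
    have h1 := LinearMap.congr_fun (mem_homSpace.1 (toMap_mem F n)) h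
    simp only [LinearMap.comp_apply] at h1
    rw [evalMap_tmul, evalMap_tmul, toMap_pairingUnit, pairingMap_apply]
    erw [toMap_slice]
    rw [convAct_apply, h1, ← hB.right]
    change _ = slice (B e) ((toMap F n).rTensor H (comul h))
    generalize (comul h : H ⊗[k] H) = t
    induction t with
    | zero => simp
    | add x y hx hy => simp only [map_add, hx, hy]
    | tmul c d => simp

/-- With `e` chosen so that `B(e, -)` acts as the counit, `toMap_evalMap` recovers the evaluation of
`F` from that of the universal map. -/
theorem ker_evalMap_le (hB : IsTwistedPairing κ B) (F : ratModule N ⟶ (homFunctor k H).obj X) :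
    LinearMap.ker (evalMap (pairingUnit hB N)) ≤ LinearMap.ker (evalMap F) := by
  intro t ht
  rw [LinearMap.mem_ker] at ht ⊢
  obtain ⟨e, he⟩ := exists_slice_eq B.flip hB.separatingRight counit (X.coact (evalMap F t))
  have h1 : slice (B e) (X.coact (evalMap F t)) = evalMap F t :=
    (congrArg (TensorProduct.rid k X) he).trans (slice_counit_coact X _)
  rw [← h1, ← toMap_evalMap hB, ht]
  exact LinearMap.congr_fun (congrArg Subtype.val F.hom.map_zero) e

/-- Every `H^*`-linear map `N → Hom^H(H, X)` factors through the universal one. -/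
theorem exists_factor (hB : IsTwistedPairing κ B) (F : ratModule N ⟶ (homFunctor k H).obj X) :
    ∃ j : pushforward N κ ⟶ X, pairingUnit hB N ≫ (homFunctor k H).map j = F := by
  obtain ⟨s, hs⟩ := LinearMap.exists_rightInverse_of_surjective (evalMap (pairingUnit hB N))
    (LinearMap.range_eq_top.2 (evalMap_pairingUnit_surjective hB N))
  -- The kernel inclusion makes `j` independent of the linear section `s`.
  let j : N →ₗ[k] X := evalMap F ∘ₗ s
  have hj : ∀ t, j (evalMap (pairingUnit hB N) t) = evalMap F t := by
    intro t
    have h1 : s (evalMap (pairingUnit hB N) t) - t ∈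
        LinearMap.ker (evalMap (pairingUnit hB N)) := by
      rw [LinearMap.mem_ker, map_sub, sub_eq_zero]
      exact LinearMap.congr_fun hs _
    have h2 := ker_evalMap_le hB F h1
    rw [LinearMap.mem_ker, map_sub, sub_eq_zero] at h2
    exact h2
  have hj' : ∀ n, j ∘ₗ pairingMap B N n = toMap F n := fun n =>
    LinearMap.ext fun h => hj (n ⊗ₜ h)
  refine ⟨⟨j, ?_⟩, ?_⟩
  · apply LinearMap.ext
    intro w
    obtain ⟨h, hh⟩ := exists_pairingMap_eq hB N w
    have h1 := LinearMap.congr_fun (mem_homSpace.1 (toMap_mem F w)) h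
    have h2 := LinearMap.congr_fun (mem_homSpace.1 (pairingMap_mem hB N w)) h
    change (pushforward N κ).coact (pairingMap B N w h) =
      (pairingMap B N w).rTensor H (comul h) at h2
    change X.coact (toMap F w h) = (toMap F w).rTensor H (comul h) at h1
    rw [hh] at h2
    change X.coact (j w) = j.rTensor H ((pushforward N κ).coact w)
    rw [h2, ← LinearMap.rTensor_comp_apply, hj', ← h1, ← hj']
    exact congrArg (fun y => X.coact (j y)) hh.symm
  · apply ModuleCat.hom_ext
    apply LinearMap.ext
    intro n
    exact Subtype.ext (hj' n)

theorem nonempty_iso_pushforward (hB : IsTwistedPairing κ B)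
    {U : ModuleCat.{u} (DualAlg k H) ⥤ RightComod k H} (adj : U ⊣ homFunctor k H)
    (N : RightComod k H) : Nonempty (U.obj (ratModule N) ≅ pushforward N κ) := by
  obtain ⟨j, hj⟩ := exists_factor hB (adj.unit.app (ratModule N))
  let g := (adj.homEquiv _ _).symm (pairingUnit hB N)
  have hg : adj.unit.app (ratModule N) ≫ (homFunctor k H).map g = pairingUnit hB N :=
    (adj.homEquiv_unit (ratModule N) _ g).symm.trans (Equiv.apply_symm_apply _ _)
  refine ⟨⟨g, j, ?_, ?_⟩⟩
  · apply (adj.homEquiv _ _).injective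
    rw [adj.homEquiv_unit, adj.homEquiv_unit, Functor.map_comp, ← Category.assoc, hg, hj,
      CategoryTheory.Functor.map_id]
    exact (Category.comp_id _).symm
  · have h1 : pairingUnit hB N ≫ (homFunctor k H).map (j ≫ g) = pairingUnit hB N := by
      rw [Functor.map_comp, ← Category.assoc, hj, hg]
    apply Subtype.ext
    apply LinearMap.ext
    intro w
    obtain ⟨h, hh⟩ := exists_pairingMap_eq hB N w
    have h2 := congrArg (fun F : ratModule N ⟶ (homFunctor k H).obj (pushforward N κ) =>
      toMap F w h) h1
    change (j ≫ g).1 (pairingMap B N w h) = pairingMap B N w h at h2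
    rw [hh] at h2
    exact h2

end Pushforward

/-! ### Double duals and tensoring with `Γ^*`. -/

section DoubleDual

variable {k H : Type u} [Field k] [Ring H] [HopfAlgebra k H]

/-- A bijective comodule map is an isomorphism. -/
def isoOfLinearEquiv {M N : RightComod k H} (e : M ≃ₗ[k] N)
    (he : ∀ m, N.coact (e m) = e.toLinearMap.rTensor H (M.coact m)) : M ≅ N where
  hom := ⟨e.toLinearMap, LinearMap.ext he⟩
  inv := ⟨e.symm.toLinearMap, LinearMap.ext fun n => by
    obtain ⟨m, rfl⟩ := e.surjective n
    change M.coact (e.symm (e m)) = e.symm.toLinearMap.rTensor H (N.coact (e m))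
    rw [he, ← LinearMap.rTensor_comp_apply, LinearEquiv.symm_comp, LinearMap.rTensor_id,
      e.symm_apply_apply]
    rfl⟩
  hom_inv_id := Subtype.ext e.symm_comp
  inv_hom_id := Subtype.ext e.comp_symm

/-- The linear equivalence underlying an isomorphism of comodules. -/
def linearEquivOfIso {M N : RightComod k H} (i : M ≅ N) : M ≃ₗ[k] N :=
  LinearEquiv.ofLinearMap i.hom.1 i.inv.1 (congrArg Subtype.val i.inv_hom_id)
    (congrArg Subtype.val i.hom_inv_id)

theorem coact_linearEquivOfIso {M N : RightComod k H} (i : M ≅ N) (m : M) :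
    N.coact (linearEquivOfIso i m) = (linearEquivOfIso i).toLinearMap.rTensor H (M.coact m) :=
  LinearMap.congr_fun i.hom.2 m

/-- The canonical isomorphism `Y → Y^{**}` twists the coaction by `S²`. -/
theorem dual_dual_coact_eval (Y : RightComod k H) [FiniteDimensional k Y] (y : Y) :
    (dual (dual Y)).coact (Module.Dual.eval k Y y) =
      TensorProduct.map (Module.Dual.eval k Y) (antipode k ∘ₗ antipode k) (Y.coact y) := by
  apply (dualTensorHomEquiv k (dual Y) H).injective
  refine (dualTensorHom_dualCoact (dual Y) (Module.Dual.eval k Y y)).trans ?_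
  apply LinearMap.ext
  intro (φ : Module.Dual k Y)
  have h1 : ∀ t : Module.Dual k Y ⊗[k] H,
      TensorProduct.lid k H ((Module.Dual.eval k Y y).rTensor H t) = dualTensorHom k Y H t y := by
    intro t
    induction t with
    | zero => simp
    | add a b ha hb => simp only [map_add, LinearMap.add_apply, ha, hb]
    | tmul a b => simp
  refine (congrArg (antipode k) (h1 (dualCoact Y φ))).trans ?_
  refine (congrArg (fun f : Y →ₗ[k] H => antipode k (f y)) (dualTensorHom_dualCoact Y φ)).trans ?_
  change antipode k (antipode k (TensorProduct.lid k H (φ.rTensor H (Y.coact y)))) =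
    dualTensorHom k (Module.Dual k Y) H
      (TensorProduct.map (Module.Dual.eval k Y) (antipode k ∘ₗ antipode k) (Y.coact y)) φ
  generalize Y.coact y = t
  induction t with
  | zero => simp
  | add a b ha hb => simp only [map_add, LinearMap.add_apply, ha, hb]
  | tmul a b =>
    rw [LinearMap.rTensor_tmul, TensorProduct.lid_tmul, map_smul, map_smul, TensorProduct.map_tmul]
    rfl

theorem dual_integralComod_coact (γ : H) (hγ : IsGroupLikeElem k γ)
    [FiniteDimensional k (rightIntegrals k H)] (ψ : Module.Dual k (rightIntegrals k H)) :
    (dual (integralComod γ hγ)).coact ψ = ψ ⊗ₜ antipode k γ := by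
  apply (dualTensorHomEquiv k (integralComod γ hγ) H).injective
  refine (dualTensorHom_dualCoact (integralComod γ hγ) ψ).trans ?_
  apply LinearMap.ext
  intro (χ : rightIntegrals k H)
  change antipode k (TensorProduct.lid k H (ψ.rTensor H (χ ⊗ₜ γ))) = ψ χ • antipode k γ
  simp

/-- Twisting by a one-dimensional comodule. -/
theorem nonempty_iso_tensor {G : RightComod k H} (l : k ≃ₗ[k] G) {c : H}
    (hG : ∀ ψ, G.coact ψ = ψ ⊗ₜ c) {N Z : RightComod k H} (θ : Z ≃ₗ[k] N)
    (hθ : ∀ z, (LinearMap.mulRight k c).lTensor N (N.coact (θ z)) =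
      θ.toLinearMap.rTensor H (Z.coact z)) : Nonempty (Z ≅ tensor N G) := by
  let Φ : Z ≃ₗ[k] N ⊗[k] G :=
    θ ≪≫ₗ (TensorProduct.rid k N).symm ≪≫ₗ TensorProduct.congr (LinearEquiv.refl k N) l
  have h1 : ∀ t : N ⊗[k] H, (LinearMap.mul' k H).lTensor (N ⊗[k] G)
      (TensorProduct.tensorTensorTensorComm k N H G H (t ⊗ₜ (l 1 ⊗ₜ c))) =
      ((TensorProduct.mk k N G).flip (l 1)).rTensor H ((LinearMap.mulRight k c).lTensor N t) := by
    intro t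
    induction t with
    | zero => simp
    | add x y hx hy => simp only [map_add, TensorProduct.add_tmul, hx, hy]
    | tmul n h => simp
  have h2 : ((TensorProduct.mk k N G).flip (l 1)) ∘ₗ θ.toLinearMap = Φ.toLinearMap := by
    ext z
    rfl
  refine ⟨isoOfLinearEquiv (N := tensor N G) Φ fun z => ?_⟩
  change (LinearMap.mul' k H).lTensor (N ⊗[k] G) (TensorProduct.tensorTensorTensorComm k N H G H
    (N.coact (θ z) ⊗ₜ G.coact (l 1))) = Φ.toLinearMap.rTensor H (Z.coact z)
  rw [hG, h1, hθ, ← LinearMap.rTensor_comp_apply, h2]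

theorem nonempty_dual_dual_iso (γ : H) (hγ : IsGroupLikeElem k γ)
    [FiniteDimensional k (rightIntegrals k H)]
    (hdim : Module.finrank k (rightIntegrals k H) = 1) {κ : H →ₗc[k] H}
    (hκ : ∀ a, twistHom γ hγ (κ a) = a) (N Y : RightComod k H) [FiniteDimensional k Y]
    (i : Y ≅ pushforward N κ) :
    Nonempty (dual (dual Y) ≅ tensor N (dual (integralComod γ hγ))) := by
  let l : k ≃ₗ[k] dual (integralComod γ hγ) :=
    LinearEquiv.ofFinrankEq _ _ (((Module.finrank_self k).trans hdim.symm).trans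
      (Subspace.dual_finrank_eq (K := k) (V := integralComod γ hγ)).symm)
  let e : Y ≃ₗ[k] dual (dual Y) := Module.evalEquiv k Y
  let φ : Y ≃ₗ[k] pushforward N κ := linearEquivOfIso i
  let θ : dual (dual Y) ≃ₗ[k] N := e.symm ≪≫ₗ φ
  refine nonempty_iso_tensor l (dual_integralComod_coact γ hγ) θ fun z => ?_
  obtain ⟨y, rfl⟩ := e.surjective z
  have h1 : (κ : H →ₗ[k] H).lTensor N (N.coact (φ y)) = φ.toLinearMap.rTensor H (Y.coact y) :=
    coact_linearEquivOfIso i y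
  have h2 : (dual (dual Y)).coact (e y) =
      TensorProduct.map e.toLinearMap (antipode k ∘ₗ antipode k) (Y.coact y) :=
    dual_dual_coact_eval Y y
  have h3 : θ.toLinearMap ∘ₗ e.toLinearMap = φ.toLinearMap :=
    LinearMap.ext fun y => congrArg φ (e.symm_apply_apply y)
  have h4 : θ (e y) = φ y := congrArg φ (e.symm_apply_apply y)
  -- From `S²(κ a) γ = a` and `γ⁻¹ = S(γ)`: the double-dual twist cancels `κ` up to right
  -- multiplication by `S(γ)`, the coefficient of `Γ^*`.
  have h5 : (antipode k ∘ₗ antipode k) ∘ₗ (κ : H →ₗ[k] H) = LinearMap.mulRight k (antipode k γ) := by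
    ext a
    conv_rhs => rw [← hκ a]
    have hγ1 : γ * antipode k γ = 1 := hγ.mul_antipode_cancel
    simp [twistHom_apply, mul_assoc, hγ1]
  rw [h2, ← LinearMap.comp_apply (LinearMap.rTensor _ _), LinearMap.rTensor_comp_map, h3, h4, ← h5,
    LinearMap.lTensor_comp_apply, h1, ← LinearMap.comp_apply, LinearMap.lTensor_comp_rTensor]

end DoubleDual
end HopfComod

theorem mainTheorem5 {k H : Type u} [Field k] [Ring H] [HopfAlgebra k H]
    (hint : HopfComod.rightIntegrals k H ≠ ⊥ ∨ HopfComod.leftIntegrals k H ≠ ⊥) :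
    (HopfComod.homFunctor k H).IsRightAdjoint ∧
    ∃ (_ : FiniteDimensional k (HopfComod.rightIntegrals k H)) (γ : H)
      (hγ : IsGroupLikeElem k γ),
      Module.finrank k (HopfComod.rightIntegrals k H) = 1 ∧
      (∀ χ ∈ HopfComod.rightIntegrals k H, ∀ a : H,
        TensorProduct.rid k H (χ.lTensor H (comul a)) = χ a • γ) ∧
      ∀ (U : ModuleCat.{u} (HopfComod.DualAlg k H) ⥤ HopfComod.RightComod k H)
        (_ : U ⊣ HopfComod.homFunctor k H)
        (N : HopfComod.RightComod k H) [FiniteDimensional k N],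
        ∃ _ : FiniteDimensional k (U.obj (HopfComod.ratModule N)),
          Nonempty (HopfComod.dual (HopfComod.dual (U.obj (HopfComod.ratModule N))) ≅
            HopfComod.tensor N (HopfComod.dual (HopfComod.integralComod γ hγ))) := by
  obtain ⟨χ, hχ, h0⟩ := HopfComod.exists_rightIntegral_ne_zero hint
  obtain ⟨γ, hγ, hχγ⟩ := HopfComod.exists_distinguished hχ h0
  have hdim := HopfComod.finrank_rightIntegrals hχ h0
  have hfin : FiniteDimensional k (HopfComod.rightIntegrals k H) :=
    FiniteDimensional.of_finrank_eq_succ hdim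
  refine ⟨HopfComod.homFunctor_isRightAdjoint k H, hfin, γ, hγ, hdim, hχγ, fun U adj N _ => ?_⟩
  obtain ⟨κ, B, hB, hκ⟩ := HopfComod.exists_twistedPairing hχ h0 hγ (hχγ χ hχ)
  obtain ⟨i⟩ := HopfComod.nonempty_iso_pushforward hB adj N
  have hU : FiniteDimensional k (U.obj (HopfComod.ratModule N)) :=
    Module.Finite.equiv (HopfComod.linearEquivOfIso i).symm
  exact ⟨hU, HopfComod.nonempty_dual_dual_iso γ hγ hdim hκ N _ i⟩
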